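/- Let $n\ge 1$. For $p,q\in\mathbb R^{2n+1}$ put $$d(p,q)=\Big(\sum_{i=1}^{2n}|p_i-q_i|^4+\Big|p_{2n+1}-q_{2n+1}+2\sum_{j=1}^n\det\begin{pmatrix}p_{2j-1}-q_{2j-1}&q_{2j-1}\\p_{2j}-q_{2j}&q_{2j}\end{pmatrix}\Big|^2\Big)^{1/4}$$ (the Korányi distance, which is comparable to the Carnot–Carathéodory metric), and let $\mathbb H_n$ be $\mathbb R^{2n+1}$ equipped with $d$. A map $f:X\to\mathbb H_n$ from a metric space is *Lipschitz* if $d(f(x),f(y))\le L\,|x-y|_X$ for some $L\ge0$ and all $x,y\in X$; it is a *Lipschitz embedding* if it is moreover injective, and a *bi-Lipschitz embedding* if $L^{-1}|x-y|_X\le d(f(x),f(y))\le L\,|x-y|_X$ for some $L>0$ and all $x,y\in X$. Let $\mathbb S^n\subset\mathbb R^{n+1}$ be the unit sphere and $\mathbb B^{n+1}$ the closed unit ball, with the Euclidean distance. Let $\pi_n^{\rm Lip}(\mathbb H_n)$ be the set of Lipschitz maps $\mathbb S^n\to\mathbb H_n$, where $f$ and $g$ are identified if there is a Lipschitz map $H:[0,1]\times\mathbb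 S^n\to\mathbb H_n$ with $H(0,\cdot)=f$ and $H(1,\cdot)=g$; an element of it is called trivial if it is the class of a constant map. Then: 1. No Lipschitz embedding $\varphi:\mathbb S^n\to\mathbb H_n$ admits a Lipschitz extension $\Phi:\mathbb B^{n+1}\to\mathbb H_n$, i.e. a Lipschitz map $\Phi$ with $\Phi|_{\mathbb S^n}=\varphi$. 2. The class in $\pi_n^{\rm Lip}(\mathbb H_n)$ of every Lipschitz embedding $\varphi:\mathbb S^n\to\mathbb H_n$ is nontrivial. 3. There is a bi-Lipschitz embedding $\mathbb S^n\to\mathbb H_n$. 4. $\pi_n^{\rm Lip}(\mathbb H_n)\neq\{0\}$, i.e. it has a nontrivial element. 5. If $k\ge n+1$ and $\Omega\subset\mathbb R^k$ is open and non-empty, then there is no injective Lipschitz map $f:\Omega\to\mathbb H_n$. -/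

import Mathlib

namespace HeisenbergLip

open Metric

/-- The underlying space `ℝ^(2n+1)` of the `n`-th Heisenberg group. All Lipschitz conditions for
maps into it are taken with respect to `hDist` below, never with respect to the Euclidean metric. -/
abbrev Heis (n : ℕ) : Type := EuclideanSpace ℝ (Fin (2 * n + 1))

/-- The coordinate `p_(2j-1)`, where `j = 1, …, n` is written as an element of `Fin n`
(which starts at `0`). -/
def cx {n : ℕ} (p : Heis n) (j : Fin n) : ℝ := p ⟨2 * j.1, by omega⟩

/-- The coordinate `p_(2j)`. -/
def cy {n : ℕ} (p : Heis n) (j : Fin n) : ℝ := p ⟨2 * j.1 + 1, by omega⟩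

/-- The last coordinate `p_(2n+1)`. -/
def ct {n : ℕ} (p : Heis n) : ℝ := p (Fin.last (2 * n))

/-- The vertical part of the Korányi distance:
`p_(2n+1) - q_(2n+1) + 2 ∑_j det (p_(2j-1) - q_(2j-1), q_(2j-1); p_(2j) - q_(2j), q_(2j))`. -/
noncomputable def hVert {n : ℕ} (p q : Heis n) : ℝ :=
  ct p - ct q + 2 * ∑ j : Fin n, Matrix.det !![cx p j - cx q j, cx q j; cy p j - cy q j, cy q j]

/-- The Korányi distance on the Heisenberg group. The first sum runs over the coordinates
`1, …, 2n` (all but the last one). -/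
noncomputable def hDist {n : ℕ} (p q : Heis n) : ℝ :=
  ((∑ i : Fin (2 * n), |p i.castSucc - q i.castSucc| ^ 4) + |hVert p q| ^ 2) ^ (1 / 4 : ℝ)

/-- Lipschitz maps from a metric space into the Heisenberg group. -/
def IsLip {X : Type*} [PseudoMetricSpace X] {n : ℕ} (f : X → Heis n) : Prop :=
  ∃ L : ℝ, 0 ≤ L ∧ ∀ x y, hDist (f x) (f y) ≤ L * dist x y

/-- Lipschitz embeddings: injective Lipschitz maps. (On a compact domain an injective continuous
map into a Hausdorff space is a homeomorphism onto its image.) -/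
def IsLipEmbedding {X : Type*} [PseudoMetricSpace X] {n : ℕ} (f : X → Heis n) : Prop :=
  IsLip f ∧ Function.Injective f

/-- Bi-Lipschitz embeddings. -/
def IsBiLip {X : Type*} [PseudoMetricSpace X] {n : ℕ} (f : X → Heis n) : Prop :=
  ∃ L : ℝ, 0 < L ∧ ∀ x y, L⁻¹ * dist x y ≤ hDist (f x) (f y) ∧
    hDist (f x) (f y) ≤ L * dist x y

/-- The unit sphere `𝕊^k` in `ℝ^(k+1)`, with the Euclidean distance of `ℝ^(k+1)`. -/
abbrev USphere (k : ℕ) : Type := sphere (0 : EuclideanSpace ℝ (Fin (k + 1))) 1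

/-- The closed unit ball in `ℝ^k`. -/
abbrev UBall (k : ℕ) : Type := closedBall (0 : EuclideanSpace ℝ (Fin k)) 1

/-- The inclusion of `𝕊^k` as the boundary of the unit ball of `ℝ^(k+1)`. -/
def sphereIncl {k : ℕ} (x : USphere k) : UBall (k + 1) := ⟨x.1, sphere_subset_closedBall x.2⟩

/-! Elementary facts about `hDist`, needed to see that Lipschitz homotopy is transitive. -/

lemma hDist_base_nonneg {n : ℕ} (p q : Heis n) :
    0 ≤ (∑ i : Fin (2 * n), |p i.castSucc - q i.castSucc| ^ 4) + |hVert p q| ^ 2 := by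
  positivity

lemma hDist_nonneg {n : ℕ} (p q : Heis n) : 0 ≤ hDist p q :=
  Real.rpow_nonneg (hDist_base_nonneg p q) _

lemma hDist_pow {n : ℕ} (p q : Heis n) : hDist p q ^ 4 =
    (∑ i : Fin (2 * n), |p i.castSucc - q i.castSucc| ^ 4) + |hVert p q| ^ 2 := by
  rw [hDist, ← Real.rpow_natCast, ← Real.rpow_mul (hDist_base_nonneg p q)]
  norm_num

lemma hDist_self {n : ℕ} (p : Heis n) : hDist p p = 0 := by
  simp [hDist, hVert, Matrix.det_fin_two_of]

lemma abs_sub_le_hDist {n : ℕ} (p q : Heis n) (i : Fin (2 * n)) :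
    |p i.castSucc - q i.castSucc| ≤ hDist p q := by
  refine le_of_pow_le_pow_left₀ (n := 4) (by norm_num) (hDist_nonneg p q) ?_
  rw [hDist_pow]
  have := Finset.single_le_sum (f := fun i : Fin (2 * n) => |p i.castSucc - q i.castSucc| ^ 4)
    (fun j _ => by positivity) (Finset.mem_univ i)
  have h2 : 0 ≤ |hVert p q| ^ 2 := by positivity
  simp only at this
  linarith

lemma abs_hVert_le {n : ℕ} (p q : Heis n) : |hVert p q| ≤ hDist p q ^ 2 := by
  refine le_of_pow_le_pow_left₀ (n := 2) (by norm_num) (by positivity) ?_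
  rw [← pow_mul, hDist_pow]
  have : 0 ≤ ∑ i : Fin (2 * n), |p i.castSucc - q i.castSucc| ^ 4 := by positivity
  linarith

lemma hVert_triangle {n : ℕ} (p q r : Heis n) : hVert p r = hVert p q + hVert q r +
    2 * ∑ j : Fin n, ((cy p j - cy q j) * (cx q j - cx r j)
      - (cx p j - cx q j) * (cy q j - cy r j)) := by
  simp only [hVert, Matrix.det_fin_two_of]
  have h : ∑ j : Fin n, ((cx p j - cx r j) * cy r j - cx r j * (cy p j - cy r j)) =
      ∑ j : Fin n, ((cx p j - cx q j) * cy q j - cx q j * (cy p j - cy q j)) +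
      ∑ j : Fin n, ((cx q j - cx r j) * cy r j - cx r j * (cy q j - cy r j)) +
      ∑ j : Fin n, ((cy p j - cy q j) * (cx q j - cx r j)
        - (cx p j - cx q j) * (cy q j - cy r j)) := by
    rw [← Finset.sum_add_distrib, ← Finset.sum_add_distrib]
    exact Finset.sum_congr rfl fun j _ => by ring
  rw [h]
  ring

/-- The triangle inequality for `hDist`, up to a constant that depends only on `n`. -/
lemma hDist_triangle (n : ℕ) : ∃ C : ℝ, 0 ≤ C ∧
    ∀ p q r : Heis n, hDist p r ≤ C * (hDist p q + hDist q r) := by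
  refine ⟨2 * n + (4 * n + 1) ^ 2 + 1, by positivity, fun p q r => ?_⟩
  set a := hDist p q with ha
  set b := hDist q r with hb
  have ha0 : 0 ≤ a := hDist_nonneg p q
  have hb0 : 0 ≤ b := hDist_nonneg q r
  have hsum : ∑ i : Fin (2 * n), |p i.castSucc - r i.castSucc| ^ 4 ≤ 2 * n * (a + b) ^ 4 := by
    calc _ ≤ ∑ _i : Fin (2 * n), (a + b) ^ 4 := by
          refine Finset.sum_le_sum fun i _ => pow_le_pow_left₀ (abs_nonneg _) ?_ 4
          have h1 := abs_sub_le_hDist p q i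
          have h2 := abs_sub_le_hDist q r i
          have h3 := abs_sub_le (p i.castSucc) (q i.castSucc) (r i.castSucc)
          linarith
      _ = _ := by simp
  have hv : |hVert p r| ≤ (4 * n + 1) * (a + b) ^ 2 := by
    rw [hVert_triangle p q r]
    have h1 : |hVert p q| ≤ a ^ 2 := abs_hVert_le p q
    have h2 : |hVert q r| ≤ b ^ 2 := abs_hVert_le q r
    have h3 : |∑ j : Fin n, ((cy p j - cy q j) * (cx q j - cx r j)
        - (cx p j - cx q j) * (cy q j - cy r j))| ≤ n * (2 * (a * b)) := by
      calc _ ≤ ∑ j : Fin n, |(cy p j - cy q j) * (cx q j - cx r j)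
            - (cx p j - cx q j) * (cy q j - cy r j)| := Finset.abs_sum_le_sum_abs _ _
        _ ≤ ∑ _j : Fin n, 2 * (a * b) := by
            refine Finset.sum_le_sum fun j _ => ?_
            have e1 : |cy p j - cy q j| ≤ a := abs_sub_le_hDist p q ⟨2 * j.1 + 1, by omega⟩
            have e2 : |cx p j - cx q j| ≤ a := abs_sub_le_hDist p q ⟨2 * j.1, by omega⟩
            have e3 : |cy q j - cy r j| ≤ b := abs_sub_le_hDist q r ⟨2 * j.1 + 1, by omega⟩
            have e4 : |cx q j - cx r j| ≤ b := abs_sub_le_hDist q r ⟨2 * j.1, by omega⟩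
            refine (abs_sub _ _).trans ?_
            rw [abs_mul, abs_mul]
            have := mul_le_mul e1 e4 (abs_nonneg _) ha0
            have := mul_le_mul e2 e3 (abs_nonneg _) ha0
            linarith
        _ = _ := by simp
    refine (abs_add_le _ _).trans ?_
    have h4 := abs_add_le (hVert p q) (hVert q r)
    rw [abs_mul, abs_two]
    have hn : (0 : ℝ) ≤ n := Nat.cast_nonneg n
    nlinarith [mul_nonneg ha0 hb0, mul_nonneg hn (mul_nonneg ha0 hb0),
      mul_nonneg hn (sq_nonneg a), mul_nonneg hn (sq_nonneg b)]
  refine le_of_pow_le_pow_left₀ (n := 4) (by norm_num) (by positivity) ?_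
  rw [hDist_pow, mul_pow]
  have hv2 : |hVert p r| ^ 2 ≤ (4 * n + 1) ^ 2 * (a + b) ^ 4 := by
    calc _ ≤ ((4 * n + 1) * (a + b) ^ 2) ^ 2 := pow_le_pow_left₀ (abs_nonneg _) hv 2
      _ = _ := by ring
  have hK : (2 * n + (4 * n + 1) ^ 2 + 1 : ℝ) ≤ (2 * n + (4 * n + 1) ^ 2 + 1 : ℝ) ^ 4 :=
    le_self_pow₀ (by nlinarith [Nat.cast_nonneg (α := ℝ) n]) (by norm_num)
  have hs : 0 ≤ (a + b) ^ 4 := by positivity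
  nlinarith [mul_le_mul_of_nonneg_right hK hs]

/-! The Lipschitz homotopy classes. -/

/-- The Lipschitz maps `𝕊^k → ℍ_n`. -/
def LipMap (k n : ℕ) : Type := {f : USphere k → Heis n // IsLip f}

/-- `f` and `g` are Lipschitz homotopic: there is a Lipschitz map `H : [0,1] × 𝕊^k → ℍ_n` with
`H(0,·) = f` and `H(1,·) = g`. -/
def LipHomotopic {k n : ℕ} (f g : LipMap k n) : Prop :=
  ∃ H : unitInterval × USphere k → Heis n, IsLip H ∧
    (∀ x, H (0, x) = f.1 x) ∧ ∀ x, H (1, x) = g.1 x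

lemma lipHomotopic_refl {k n : ℕ} (f : LipMap k n) : LipHomotopic f f := by
  obtain ⟨L, hL, h⟩ := f.2
  refine ⟨fun z => f.1 z.2, ⟨L, hL, fun z w => (h _ _).trans ?_⟩, fun _ => rfl, fun _ => rfl⟩
  exact mul_le_mul_of_nonneg_left (le_max_right _ _) hL

lemma lipHomotopic_symm {k n : ℕ} {f g : LipMap k n} (h : LipHomotopic f g) :
    LipHomotopic g f := by
  obtain ⟨H, ⟨L, hL, hH⟩, h0, h1⟩ := h
  refine ⟨fun z => H (unitInterval.symm z.1, z.2), ⟨L, hL, fun z w => (hH _ _).trans ?_⟩,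
    fun x => by simpa using h1 x, fun x => by simpa using h0 x⟩
  refine mul_le_mul_of_nonneg_left (le_of_eq ?_) hL
  rw [Prod.dist_eq, Prod.dist_eq]
  congr 1
  simp only [Subtype.dist_eq, unitInterval.coe_symm_eq, Real.dist_eq]
  rw [abs_sub_comm]
  congr 1
  ring

lemma lip_reparam {k n : ℕ} {H : unitInterval × USphere k → Heis n} {L : ℝ} (hL : 0 ≤ L)
    (hH : ∀ x y, hDist (H x) (H y) ≤ L * dist x y) (a b : ℝ) (x y : USphere k) :
    hDist (H (Set.projIcc 0 1 zero_le_one a, x)) (H (Set.projIcc 0 1 zero_le_one b, y))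
      ≤ L * (|a - b| + dist x y) := by
  refine (hH _ _).trans (mul_le_mul_of_nonneg_left ?_ hL)
  rw [Prod.dist_eq]
  have h1 : dist (Set.projIcc (0 : ℝ) 1 zero_le_one a) (Set.projIcc (0 : ℝ) 1 zero_le_one b)
      ≤ |a - b| := by
    rw [Subtype.dist_eq, Real.dist_eq]
    exact Set.abs_projIcc_sub_projIcc zero_le_one
  have h2 : 0 ≤ dist x y := dist_nonneg
  have h3 : 0 ≤ |a - b| := abs_nonneg _
  exact max_le (by linarith) (by linarith)

lemma lipHomotopic_trans {k n : ℕ} {f g h : LipMap k n} (hfg : LipHomotopic f g)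
    (hgh : LipHomotopic g h) : LipHomotopic f h := by
  obtain ⟨A, ⟨L, hL, hA⟩, A0, A1⟩ := hfg
  obtain ⟨B, ⟨M, hM, hB⟩, B0, B1⟩ := hgh
  obtain ⟨C, hC, hT⟩ := hDist_triangle n
  let P : ℝ → unitInterval := Set.projIcc 0 1 zero_le_one
  have P0 : P 0 = 0 := Set.projIcc_left _
  have P1 : P 1 = 1 := Set.projIcc_right _
  let A' : ℝ → USphere k → Heis n := fun s x => A (P (2 * s), x)
  let B' : ℝ → USphere k → Heis n := fun s x => B (P (2 * s - 1), x)
  have hA' : ∀ s t x y, hDist (A' s x) (A' t y) ≤ L * (2 * |s - t| + dist x y) := by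
    intro s t x y
    have := lip_reparam hL hA (2 * s) (2 * t) x y
    rwa [← mul_sub, abs_mul, abs_two] at this
  have hB' : ∀ s t x y, hDist (B' s x) (B' t y) ≤ M * (2 * |s - t| + dist x y) := by
    intro s t x y
    have := lip_reparam hM hB (2 * s - 1) (2 * t - 1) x y
    rwa [sub_sub_sub_cancel_right, ← mul_sub, abs_mul, abs_two] at this
  have hmid : ∀ x, A' (1 / 2) x = B' (1 / 2) x := by
    intro x
    show A (P (2 * (1 / 2)), x) = B (P (2 * (1 / 2) - 1), x)
    norm_num [P0, P1, A1, B0]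
  have key : ∀ (s t : ℝ) (x y : USphere k), s ≤ 1 / 2 → 1 / 2 < t →
      hDist (A' s x) (B' t y) ≤ C * (L + M) * (2 * |s - t| + dist x y) ∧
      hDist (B' t y) (A' s x) ≤ C * (L + M) * (2 * |s - t| + dist x y) := by
    intro s t x y hs ht
    have e1 : |s - 1 / 2| ≤ |s - t| := by
      rw [abs_of_nonpos (by linarith), abs_of_nonpos (by linarith)]; linarith
    have e2 : |1 / 2 - t| ≤ |s - t| := by
      rw [abs_of_nonpos (by linarith), abs_of_nonpos (by linarith)]; linarith
    have hd : 0 ≤ dist x y := dist_nonneg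
    have a1 : L * (2 * |s - 1 / 2| + dist x x) ≤ L * (2 * |s - t| + dist x y) := by
      rw [dist_self]; gcongr
    have a2 : M * (2 * |1 / 2 - t| + dist x y) ≤ M * (2 * |s - t| + dist x y) := by gcongr
    have c1 := hA' s (1 / 2) x x
    have c2 := hB' (1 / 2) t x y
    have c3 := hA' (1 / 2) s x x
    have c4 := hB' t (1 / 2) y x
    rw [abs_sub_comm (1 / 2) s] at c3
    rw [abs_sub_comm t (1 / 2), dist_comm y x] at c4
    constructor
    · refine (hT _ (A' (1 / 2) x) _).trans ?_
      rw [mul_assoc]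
      refine mul_le_mul_of_nonneg_left ?_ hC
      rw [add_mul]
      rw [← hmid x] at c2
      linarith
    · refine (hT _ (B' (1 / 2) x) _).trans ?_
      rw [mul_assoc]
      refine mul_le_mul_of_nonneg_left ?_ hC
      rw [add_mul]
      rw [hmid x] at c3
      linarith
  let H : unitInterval × USphere k → Heis n := fun z =>
    if (z.1 : ℝ) ≤ 1 / 2 then A' z.1 z.2 else B' z.1 z.2
  refine ⟨H, ⟨3 * (L + M + C * (L + M)), by positivity, ?_⟩, ?_, ?_⟩
  · rintro ⟨s, x⟩ ⟨t, y⟩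
    have hD : 2 * |(s : ℝ) - t| + dist x y ≤ 3 * dist (s, x) (t, y) := by
      rw [Prod.dist_eq]
      have h1 : |(s : ℝ) - t| ≤ max (dist s t) (dist x y) := by
        rw [← Real.dist_eq, ← Subtype.dist_eq]; exact le_max_left _ _
      have h2 : dist x y ≤ max (dist s t) (dist x y) := le_max_right _ _
      show 2 * |(s : ℝ) - t| + dist x y ≤ 3 * max (dist s t) (dist x y)
      linarith
    have hnn : 0 ≤ 2 * |(s : ℝ) - t| + dist x y := by positivity
    have hCLM : 0 ≤ C * (L + M) := by positivity
    have hfin : ∀ K, K ≤ L + M + C * (L + M) →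
        K * (2 * |(s : ℝ) - t| + dist x y) ≤ 3 * (L + M + C * (L + M)) * dist (s, x) (t, y) := by
      intro K hK
      calc _ ≤ (L + M + C * (L + M)) * (2 * |(s : ℝ) - t| + dist x y) :=
            mul_le_mul_of_nonneg_right hK hnn
        _ ≤ (L + M + C * (L + M)) * (3 * dist (s, x) (t, y)) :=
            mul_le_mul_of_nonneg_left hD (by positivity)
        _ = _ := by ring
    by_cases hs : (s : ℝ) ≤ 1 / 2 <;> by_cases ht : (t : ℝ) ≤ 1 / 2
    · simp only [H, if_pos hs, if_pos ht]
      exact (hA' _ _ _ _).trans (hfin L (by linarith))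
    · simp only [H, if_pos hs, if_neg ht]
      exact (key _ _ _ _ hs (not_le.1 ht)).1.trans (hfin _ (by linarith))
    · simp only [H, if_neg hs, if_pos ht]
      have := (key t s y x ht (not_le.1 hs)).2
      rw [abs_sub_comm, dist_comm y x] at this
      exact this.trans (hfin _ (by linarith))
    · simp only [H, if_neg hs, if_neg ht]
      exact (hB' _ _ _ _).trans (hfin M (by linarith))
  · intro x
    have : ((0 : unitInterval) : ℝ) ≤ 1 / 2 := by norm_num
    simp only [H, if_pos this, A']
    norm_num [P0, A0]
  · intro x
    have : ¬ ((1 : unitInterval) : ℝ) ≤ 1 / 2 := by norm_num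
    simp only [H, if_neg this, B']
    norm_num [P1, B1]

/-- Lipschitz homotopy as an equivalence relation on the Lipschitz maps `𝕊^k → ℍ_n`. -/
instance lipSetoid (k n : ℕ) : Setoid (LipMap k n) where
  r := LipHomotopic
  iseqv := ⟨lipHomotopic_refl, lipHomotopic_symm, lipHomotopic_trans⟩

/-- `π_k^Lip(ℍ_n)`: the Lipschitz maps `𝕊^k → ℍ_n` up to Lipschitz homotopy. -/
def PiLip (k n : ℕ) : Type := Quotient (lipSetoid k n)

/-- The class of a Lipschitz map in `π_k^Lip(ℍ_n)`. -/
def lipClass {k n : ℕ} (f : LipMap k n) : PiLip k n := Quotient.mk (lipSetoid k n) f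

/-- The constant map `𝕊^k → ℍ_n` with value `c`. -/
def constMap (k : ℕ) {n : ℕ} (c : Heis n) : LipMap k n :=
  ⟨fun _ => c, 0, le_rfl, fun _ _ => by rw [hDist_self, zero_mul]⟩

end HeisenbergLip

/-! A Lipschitz map from `ℝ^(n+1)` to `ℍ_n` loses rank wherever it is differentiable, while degree
theory forbids rank loss almost everywhere for an extension of an embedded sphere.

Rank: on bounded sets the Korányi distance dominates the Euclidean one, so Rademacher's theorem
applies. At a point of differentiability the vertical parts of the blow-ups vanish
(`tendsto_hVert_blowup`). Hence the derivative is isotropic for the symplectic form and its vertical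
component is determined by the horizontal ones, so it has rank at most `n`
(`exists_ne_zero_fderiv_apply_eq_zero`).

Degree: if a Lipschitz map `x + g x` is the identity off a ball, the integral of `det (1 + t Dg)`
over the ball is a polynomial in `t`. For small `t` it is the volume of the ball, by change of
variables, so it is the volume at `t = 1` too (`not_ae_det_eq_zero_of_eq_id_off_ball`).

Suppose an embedding `φ` extends to `Φ`. The inverse of `φ` is merely continuous, but some Lipschitz
`ψ` has `ψ ∘ φ` within `1/2` of the identity. Inside the unit ball `ψ ∘ Φ` is singular because `Φ`
is; across a shell it is interpolated to the identity with values in a sphere, where it is singular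
again. This contradicts the degree statement (`false_of_singular_of_near_id`).

A null homotopy yields an extension, and so does a small ball inside an open set mapped injectively.
The bi-Lipschitz sphere is a Legendrian lift of the Whitney immersion, whose double point the
vertical coordinate separates. -/

namespace HeisenbergLip

open Metric MeasureTheory Set Filter
open scoped NNReal ENNReal Topology

/-! ### Degree theory through the integral of the Jacobian -/

section Degree

variable {E : Type*} [NormedAddCommGroup E] [NormedSpace ℝ E] [FiniteDimensional ℝ E]

/-- The determinant of `1 + t • A` is a polynomial in `t` of degree at most the dimension. -/
lemma exists_polynomial_det (A : E →L[ℝ] E) : ∃ p : Polynomial ℝ,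
    p.natDegree ≤ Module.finrank ℝ E ∧
      ∀ t : ℝ, p.eval t = (ContinuousLinearMap.id ℝ E + t • A).det := by
  let b := Module.finBasis ℝ E
  let M := LinearMap.toMatrix b b (A : E →ₗ[ℝ] E)
  refine ⟨_, (Polynomial.natDegree_det_X_add_C_le M 1).trans (by simp), fun t => ?_⟩
  rw [ContinuousLinearMap.det, ← LinearMap.det_toMatrix b, ← Polynomial.coe_evalRingHom,
    RingHom.map_det]
  congr 1
  simp only [ContinuousLinearMap.toLinearMap_add, ContinuousLinearMap.toLinearMap_smul,
    ContinuousLinearMap.coe_id, map_add, map_smul, LinearMap.toMatrix_id]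
  ext i j
  by_cases h : i = j <;> simp [h, M, add_comm, mul_comm t]

/-- Lagrange interpolation at `m + 1` nodes in `[0, ε]`, evaluated at `1`. It carries information
about small `t` to `t = 1` without integrating the coefficients of a polynomial. -/
lemma exists_interpolation_weights (m : ℕ) {ε : ℝ} (hε : 0 < ε) :
    ∃ t w : Fin (m + 1) → ℝ, (∀ i, 0 ≤ t i ∧ t i ≤ ε) ∧ ∑ i, w i = 1 ∧
      ∀ p : Polynomial ℝ, p.natDegree ≤ m → p.eval 1 = ∑ i, w i * p.eval (t i) := by
  let t : Fin (m + 1) → ℝ := fun i => ε * ((i : ℝ) / (m + 1))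
  have ht : Function.Injective t := by
    intro i j hij
    have h1 : (i : ℝ) / (m + 1) = (j : ℝ) / (m + 1) := mul_left_cancel₀ hε.ne' hij
    have hm : ((m : ℝ) + 1) ≠ 0 := by positivity
    rw [div_left_inj' hm] at h1
    exact Fin.ext (by exact_mod_cast h1)
  have key : ∀ p : Polynomial ℝ, p.natDegree ≤ m →
      p.eval 1 = ∑ i, (Lagrange.basis Finset.univ t i).eval 1 * p.eval (t i) := by
    intro p hp
    have hd : p.degree < (Finset.univ : Finset (Fin (m + 1))).card := by
      rw [Finset.card_fin]
      exact lt_of_le_of_lt Polynomial.degree_le_natDegree (by exact_mod_cast Nat.lt_succ_of_le hp)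
    conv_lhs => rw [Lagrange.eq_interpolate (s := Finset.univ) ht.injOn hd,
      Lagrange.interpolate_apply, Polynomial.eval_finsetSum]
    exact Finset.sum_congr rfl fun i _ => by simp [mul_comm]
  refine ⟨t, fun i => (Lagrange.basis Finset.univ t i).eval 1, fun i => ⟨by positivity, ?_⟩, ?_, key⟩
  · refine mul_le_of_le_one_right hε.le ?_
    rw [div_le_one (by positivity)]
    have := i.2
    exact_mod_cast this.le
  · simpa using (key 1 (by simp)).symm

/-- The determinant is `1` at `s = 0` and cannot vanish for `s` in `[0, t]`: a kernel vector would
satisfy `v = -s A v` and be shorter than itself. -/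
lemma det_id_add_smul_pos {A : E →L[ℝ] E} {t : ℝ} (ht0 : 0 ≤ t) (ht : t * ‖A‖ < 1) :
    0 < (ContinuousLinearMap.id ℝ E + t • A).det := by
  obtain ⟨p, -, hp⟩ := exists_polynomial_det A
  have hne : ∀ s, 0 ≤ s → s ≤ t → p.eval s ≠ 0 := by
    intro s hs0 hst h0
    rw [hp, ContinuousLinearMap.det] at h0
    have hs1 : s * ‖A‖ < 1 := lt_of_le_of_lt (by gcongr) ht
    obtain ⟨v, hv, hv0⟩ := (Submodule.ne_bot_iff _).1 (LinearMap.bot_lt_ker_of_det_eq_zero h0).ne'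
    have h1 : v = -(s • A v) := eq_neg_of_add_eq_zero_left (by simpa using hv)
    have h2 : ‖v‖ ≤ s * ‖A‖ * ‖v‖ := by
      conv_lhs => rw [h1, norm_neg, norm_smul, Real.norm_of_nonneg hs0]
      rw [mul_assoc]
      gcongr
      exact A.le_opNorm v
    have h3 : 0 < ‖v‖ := norm_pos_iff.2 hv0
    nlinarith
  have h0 : p.eval 0 = 1 := by rw [hp]; simp [ContinuousLinearMap.det]
  rw [← hp]
  by_contra hneg
  obtain ⟨s, hs, hs0⟩ := intermediate_value_Icc' ht0 p.continuous.continuousOn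
    (show (0 : ℝ) ∈ Icc (p.eval t) (p.eval 0) from ⟨not_lt.1 hneg, by rw [h0]; norm_num⟩)
  exact hne s hs.1 hs.2 hs0

/-- A small Lipschitz perturbation of the identity which is the identity off a ball maps this
ball bijectively to itself. -/
lemma bijOn_closedBall_of_small {g : E → E} {c : ℝ≥0} (hc : c < 1)
    (hg : LipschitzWith c g) {R : ℝ} (h0 : ∀ x, R ≤ ‖x‖ → g x = 0) :
    BijOn (fun x => x + g x) (closedBall 0 R) (closedBall 0 R) := by
  have hinj : Function.Injective fun x => x + g x := by
    intro x y hxy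
    have h1 : x - y = g y - g x := by
      have h2 : x + g x = y + g y := hxy
      rw [sub_eq_sub_iff_add_eq_add, h2, add_comm]
    have h2 : ‖x - y‖ ≤ c * ‖x - y‖ := by
      conv_lhs => rw [h1]
      rw [← dist_eq_norm, dist_comm, ← dist_eq_norm]
      exact hg.dist_le_mul x y
    have h3 : (c : ℝ) < 1 := hc
    have h4 : ‖x - y‖ = 0 := by nlinarith [norm_nonneg (x - y)]
    exact sub_eq_zero.1 (norm_eq_zero.1 h4)
  have hsurj : Function.Surjective fun x => x + g x := by
    intro y
    have hk : ContractingWith c fun x => y - g x :=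
      ⟨hc, by simpa using (LipschitzWith.const y).sub hg⟩
    refine ⟨hk.fixedPoint, ?_⟩
    have : y - g hk.fixedPoint = hk.fixedPoint := hk.fixedPoint_isFixedPt
    exact eq_sub_iff_add_eq.1 this.symm
  refine ⟨fun x hx => ?_, hinj.injOn, fun y hy => ?_⟩
  · by_contra hne
    simp only [mem_closedBall, dist_zero_right, not_le] at hne hx
    -- An image point outside the ball is itself fixed, so injectivity would identify it with `x`.
    have h1 : x + g x + g (x + g x) = x + g x := by rw [h0 _ hne.le, add_zero]
    have h2 := hinj h1
    rw [h2] at hne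
    exact absurd hx (not_le.2 hne)
  · obtain ⟨x, hx⟩ := hsurj y
    refine ⟨x, ?_, hx⟩
    by_contra hne
    simp only [mem_closedBall, dist_zero_right, not_le] at hne hy
    simp only [h0 x hne.le, add_zero] at hx
    rw [hx] at hne
    exact absurd hy (not_le.2 hne)

variable [MeasurableSpace E] [BorelSpace E]

/-- For small `t` the map `x + t g x` is a bijection of the ball with positive Jacobian, so this is
the change of variables formula. The top-dimensional Hausdorff measure serves as volume because
Lipschitz maps preserve its null sets; this disposes of the points where `g` is not differentiable.
-/
lemma integral_det_id_add_smul_fderiv {g : E → E} {K : ℝ≥0} (hg : LipschitzWith K g) {R : ℝ}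
    (h0 : ∀ x, R ≤ ‖x‖ → g x = 0) {t : ℝ} (ht0 : 0 ≤ t) (ht : t * K < 1) :
    IntegrableOn (fun x => (ContinuousLinearMap.id ℝ E + t • fderiv ℝ g x).det) (closedBall 0 R)
        μH[Module.finrank ℝ E] ∧
      ∫ x in closedBall 0 R, (ContinuousLinearMap.id ℝ E + t • fderiv ℝ g x).det
        ∂μH[Module.finrank ℝ E] = (μH[Module.finrank ℝ E] : Measure E).real (closedBall 0 R) := by
  set μ : Measure E := μH[Module.finrank ℝ E] with hμ
  set B : Set E := closedBall 0 R
  let D : Set E := {x | DifferentiableAt ℝ g x}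
  have hD : MeasurableSet D := measurableSet_of_differentiableAt ℝ g
  have hDc : μ Dᶜ = 0 := hg.ae_differentiableAt
  have hBD : (B ∩ D : Set E) =ᵐ[μ] B :=
    inter_ae_eq_left_of_ae_eq_univ (Filter.eventuallyEq_univ.2 hg.ae_differentiableAt)
  have hs : MeasurableSet (B ∩ D) := measurableSet_closedBall.inter hD
  have hlip : LipschitzWith (t.toNNReal * K) fun x => t • g x := by
    refine LipschitzWith.of_dist_le_mul fun x y => ?_
    rw [dist_smul₀, Real.norm_of_nonneg ht0, NNReal.coe_mul, Real.coe_toNNReal t ht0, mul_assoc]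
    gcongr
    exact hg.dist_le_mul x y
  have hc : t.toNNReal * K < 1 := by
    rw [← NNReal.coe_lt_coe, NNReal.coe_mul, Real.coe_toNNReal t ht0]; exact_mod_cast ht
  have hbij := bijOn_closedBall_of_small hc hlip (R := R) fun x hx => by rw [h0 x hx, smul_zero]
  have hder : ∀ x ∈ B ∩ D, HasFDerivWithinAt (fun x => x + t • g x)
      (ContinuousLinearMap.id ℝ E + t • fderiv ℝ g x) (B ∩ D) x := fun x hx =>
    ((hasFDerivAt_id x).add (hx.2.hasFDerivAt.const_smul t)).hasFDerivWithinAt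
  have hinj : InjOn (fun x => x + t • g x) (B ∩ D) := hbij.injOn.mono inter_subset_left
  have hG : LipschitzWith (1 + t.toNNReal * K) fun x => x + t • g x :=
    LipschitzWith.id.add hlip
  have himg : (fun x => x + t • g x) '' (B ∩ D) =ᵐ[μ] B := by
    refine Filter.EventuallyLE.antisymm
      (Filter.Eventually.of_forall (fun y hy => ?_)) ?_
    · obtain ⟨x, hx, rfl⟩ := hy
      exact hbij.mapsTo hx.1
    · refine ae_le_set.2 (measure_mono_null (t := (fun x => x + t • g x) '' Dᶜ) ?_ ?_)
      · rintro y ⟨hyB, hy⟩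
        obtain ⟨x, hx, rfl⟩ := hbij.surjOn hyB
        exact ⟨x, fun hxD => hy ⟨x, ⟨hx, hxD⟩, rfl⟩, rfl⟩
      · have := hG.hausdorffMeasure_image_le (d := Module.finrank ℝ E) (by positivity) Dᶜ
        rw [← hμ, hDc, mul_zero] at this
        exact le_antisymm this zero_le
  have hpos : ∀ x, |(ContinuousLinearMap.id ℝ E + t • fderiv ℝ g x).det|
      = (ContinuousLinearMap.id ℝ E + t • fderiv ℝ g x).det := fun x =>
    abs_of_pos (det_id_add_smul_pos ht0 (lt_of_le_of_lt
      (mul_le_mul_of_nonneg_left (norm_fderiv_le_of_lipschitz ℝ hg) ht0) ht))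
  have h1 := integrableOn_image_iff_integrableOn_abs_det_fderiv_smul μ hs hder hinj
    (fun _ => (1 : ℝ))
  have h2 := integral_image_eq_integral_abs_det_fderiv_smul μ hs hder hinj (fun _ => (1 : ℝ))
  simp only [smul_eq_mul, mul_one, hpos] at h1 h2
  rw [setIntegral_congr_set himg, setIntegral_congr_set hBD] at h2
  rw [integrableOn_congr_set_ae himg, integrableOn_congr_set_ae hBD] at h1
  refine ⟨h1.1 ?_, ?_⟩
  · exact integrableOn_const (measure_closedBall_lt_top (x := (0 : E)) (r := R)).ne
  · rw [← h2]; simp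

/-- A Lipschitz map which is the identity off a ball does not have a singular derivative almost
everywhere in the ball. -/
theorem not_ae_det_eq_zero_of_eq_id_off_ball {g : E → E} {K : ℝ≥0} (hg : LipschitzWith K g)
    {R : ℝ} (hR : 0 < R) (h0 : ∀ x, R ≤ ‖x‖ → g x = 0) :
    ¬ ∀ᵐ x ∂(μH[Module.finrank ℝ E] : Measure E), x ∈ closedBall (0 : E) R →
      (ContinuousLinearMap.id ℝ E + fderiv ℝ g x).det = 0 := by
  intro h
  set μ : Measure E := μH[Module.finrank ℝ E] with hμ
  -- The bound `1 / (K + 1)` on the nodes makes `t i * K < 1`.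
  obtain ⟨t, w, ht, hw, hint⟩ := exists_interpolation_weights (Module.finrank ℝ E)
    (ε := 1 / ((K : ℝ) + 1)) (by positivity)
  have htK : ∀ i, t i * K < 1 := fun i => by
    have hK : (0 : ℝ) ≤ K := K.2
    have h1 := mul_le_mul_of_nonneg_right (ht i).2 hK
    refine lt_of_le_of_lt h1 ?_
    rw [one_div_mul_eq_div, div_lt_one (by positivity)]
    linarith
  have hI := fun i => integral_det_id_add_smul_fderiv hg h0 (ht i).1 (htK i)
  have hsum : ∀ x, (ContinuousLinearMap.id ℝ E + fderiv ℝ g x).det =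
      ∑ i, w i * (ContinuousLinearMap.id ℝ E + t i • fderiv ℝ g x).det := fun x => by
    obtain ⟨p, hp, hpe⟩ := exists_polynomial_det (fderiv ℝ g x)
    simpa [hpe] using hint p hp
  have hzero : ∫ x in closedBall 0 R, (ContinuousLinearMap.id ℝ E + fderiv ℝ g x).det ∂μ = 0 := by
    rw [setIntegral_congr_ae measurableSet_closedBall (g := fun _ => (0 : ℝ)) h]
    simp
  simp_rw [hsum] at hzero
  rw [integral_finsetSum _ fun i _ => ((hI i).1.const_mul _)] at hzero
  simp_rw [integral_const_mul, (hI _).2, ← Finset.sum_mul, hw, one_mul] at hzero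
  have hpos : 0 < μ (closedBall (0 : E) R) := measure_closedBall_pos μ 0 hR
  rw [measureReal_def, ENNReal.toReal_eq_zero_iff] at hzero
  rcases hzero with h1 | h1
  · exact hpos.ne' h1
  · exact (measure_closedBall_lt_top (x := (0 : E)) (r := R)).ne h1

end Degree
-- Radial projections
section Radial

variable {E : Type*} [NormedAddCommGroup E] [NormedSpace ℝ E]

/-- The radial projection `x ↦ x / max (‖x‖, c)`. -/
noncomputable def radial (c : ℝ) (x : E) : E := (max ‖x‖ c)⁻¹ • x

lemma norm_radial {c : ℝ} (hc : 0 < c) (x : E) : ‖radial c x‖ = ‖x‖ / max ‖x‖ c := by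
  have : 0 < max ‖x‖ c := lt_max_of_lt_right hc
  rw [radial, norm_smul, Real.norm_of_nonneg (by positivity), div_eq_inv_mul]

lemma norm_radial_le {c : ℝ} (hc : 0 < c) (x : E) : ‖radial c x‖ ≤ 1 := by
  have : 0 < max ‖x‖ c := lt_max_of_lt_right hc
  rw [norm_radial hc, div_le_one this]
  exact le_max_left _ _

lemma norm_radial_eq {c : ℝ} (hc : 0 < c) {x : E} (hx : c ≤ ‖x‖) : ‖radial c x‖ = 1 := by
  rw [norm_radial hc, max_eq_left hx, div_self (hc.trans_le hx).ne']

lemma smul_radial_of_le {c : ℝ} (hc : 0 < c) {x : E} (hx : ‖x‖ ≤ c) : c • radial c x = x := by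
  rw [radial, max_eq_right hx, smul_smul, mul_inv_cancel₀ hc.ne', one_smul]

lemma norm_smul_radial {c : ℝ} (hc : 0 < c) {x : E} (hx : c ≤ ‖x‖) : ‖x‖ • radial c x = x := by
  rw [radial, max_eq_left hx, smul_smul, mul_inv_cancel₀ (hc.trans_le hx).ne', one_smul]

lemma lipschitzWith_radial {c : ℝ} (hc : 0 < c) :
    LipschitzWith (2 / c).toNNReal (radial c : E → E) := by
  refine LipschitzWith.of_dist_le_mul fun x y => ?_
  rw [Real.coe_toNNReal _ (by positivity), dist_eq_norm, dist_eq_norm]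
  set a := max ‖x‖ c with ha
  set b := max ‖y‖ c with hb
  have ha0 : 0 < a := lt_max_of_lt_right hc
  have hb0 : 0 < b := lt_max_of_lt_right hc
  have hca : a⁻¹ ≤ c⁻¹ := inv_anti₀ hc (le_max_right _ _)
  have hab : |b - a| ≤ ‖x - y‖ := by
    refine (abs_max_sub_max_le_abs _ _ _).trans ?_
    rw [abs_sub_comm]; exact abs_norm_sub_norm_le x y
  have hyb : b⁻¹ * ‖y‖ ≤ 1 := by
    rw [inv_mul_le_one₀ hb0]; exact le_max_left _ _
  -- Both terms have norm at most `c⁻¹ * ‖x - y‖`, whence the constant `2 / c`.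
  have e : radial c x - radial c y = a⁻¹ • (x - y) + (a⁻¹ * (b - a)) • (b⁻¹ • y) := by
    have : a⁻¹ * (b - a) * b⁻¹ = a⁻¹ - b⁻¹ := by field_simp
    rw [smul_smul, this, smul_sub, sub_smul, radial, radial]
    abel
  rw [e]
  calc _ ≤ ‖a⁻¹ • (x - y)‖ + ‖(a⁻¹ * (b - a)) • (b⁻¹ • y)‖ := norm_add_le _ _
    _ = a⁻¹ * ‖x - y‖ + a⁻¹ * |b - a| * (b⁻¹ * ‖y‖) := by
      rw [norm_smul, norm_smul, norm_smul, norm_mul, norm_inv, norm_inv,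
        Real.norm_of_nonneg ha0.le, Real.norm_of_nonneg hb0.le, Real.norm_eq_abs]
    _ ≤ c⁻¹ * ‖x - y‖ + c⁻¹ * ‖x - y‖ * 1 := by gcongr
    _ = _ := by ring

/-- The radial retraction onto the closed unit ball. -/
noncomputable def ballRetraction (x : E) : closedBall (0 : E) 1 :=
  ⟨radial 1 x, by simpa using norm_radial_le one_pos x⟩

lemma dist_ballRetraction_le (x y : E) :
    dist (ballRetraction x) (ballRetraction y) ≤ 2 * dist x y := by
  simpa [ballRetraction, Subtype.dist_eq] using
    (lipschitzWith_radial (E := E) one_pos).dist_le_mul x y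

end Radial

/-! ### Products of bounded Lipschitz maps -/

section Bounded

variable {X : Type*} [PseudoMetricSpace X] {E : Type*} [NormedAddCommGroup E] [NormedSpace ℝ E]

lemma lipschitz_smul_of_bounded {s : X → ℝ} {h : X → E} {K L : ℝ≥0} (hs : LipschitzWith K s)
    (hh : LipschitzWith L h) {a b : ℝ≥0} (ha : ∀ x, |s x| ≤ a) (hb : ∀ x, ‖h x‖ ≤ b) :
    LipschitzWith (a * L + K * b) fun x => s x • h x := by
  refine LipschitzWith.of_dist_le_mul fun x y => ?_
  have e : s x • h x - s y • h y = s x • (h x - h y) + (s x - s y) • h y := by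
    rw [smul_sub, sub_smul]; abel
  rw [dist_eq_norm, e]
  have h1 := hs.dist_le_mul x y
  have h2 := hh.dist_le_mul x y
  rw [Real.dist_eq] at h1
  rw [dist_eq_norm] at h2
  calc _ ≤ ‖s x • (h x - h y)‖ + ‖(s x - s y) • h y‖ := norm_add_le _ _
    _ = |s x| * ‖h x - h y‖ + |s x - s y| * ‖h y‖ := by
      rw [norm_smul, norm_smul, Real.norm_eq_abs, Real.norm_eq_abs]
    _ ≤ a * (L * dist x y) + K * dist x y * b := by
      gcongr
      · exact ha x
      · exact hb y
    _ = _ := by push_cast; ring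

end Bounded

/-! ### Lipschitz approximation of a continuous inverse -/

section Inverse

variable {S E : Type*} [TopologicalSpace S] [CompactSpace S] [Nonempty S]
  [PseudoMetricSpace E]

/-- A continuous function on the homeomorphic image of a compact space is approximated by
Lipschitz functions. -/
lemma exists_lipschitz_near_of_injective [T0Space E] {φ : S → E} (hφ : Continuous φ)
    (hinj : Function.Injective φ) {u : S → ℝ} (hu : Continuous u) {ε : ℝ} (hε : 0 < ε) :
    ∃ (N : ℝ≥0) (ψ : E → ℝ), LipschitzWith N ψ ∧ ∀ x, |ψ (φ x) - u x| ≤ ε := by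
  obtain ⟨N, hN⟩ : ∃ N : ℝ≥0, ∀ x y, u x ≤ u y + ε + N * dist (φ x) (φ y) := by
    -- Only pairs in `Q` need the distance term. By compactness and injectivity their images stay at
    -- least `δ` apart, so a slope `2 M / δ` covers the oscillation of `u`.
    let Q : Set (S × S) := {z | u z.2 + ε ≤ u z.1}
    have hQ : IsCompact Q := (isClosed_le (by fun_prop) (by fun_prop)).isCompact
    obtain ⟨M, hM⟩ := isCompact_univ.exists_bound_of_continuousOn hu.continuousOn
    have hM' : ∀ x, |u x| ≤ M := fun x => hM x (mem_univ x)
    obtain ⟨δ, hδ, hδQ⟩ : ∃ δ : ℝ, 0 < δ ∧ ∀ z ∈ Q, δ ≤ dist (φ z.1) (φ z.2) := by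
      rcases Q.eq_empty_or_nonempty with hQe | hQn
      · exact ⟨1, one_pos, fun z hz => by rw [hQe] at hz; exact hz.elim⟩
      · obtain ⟨z, hz, hmin⟩ := hQ.exists_isMinOn hQn
          (f := fun z => dist (φ z.1) (φ z.2)) (by fun_prop)
        refine ⟨_, ?_, fun w hw => hmin hw⟩
        refine lt_of_le_of_ne dist_nonneg fun h => ?_
        have h1 : z.1 = z.2 := hinj ((Metric.inseparable_iff.2 h.symm).eq)
        have h2 : u z.2 + ε ≤ u z.1 := hz
        rw [h1] at h2
        linarith
    have hM0 : 0 ≤ M := (abs_nonneg _).trans (hM' (Classical.arbitrary S))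
    refine ⟨(2 * M / δ).toNNReal, fun x y => ?_⟩
    rw [Real.coe_toNNReal _ (by positivity)]
    by_cases hxy : u y + ε ≤ u x
    · have h1 := hδQ (x, y) hxy
      have h2 : 2 * M / δ * δ ≤ 2 * M / δ * dist (φ x) (φ y) :=
        mul_le_mul_of_nonneg_left h1 (by positivity)
      rw [div_mul_cancel₀ _ hδ.ne'] at h2
      have h3 := abs_le.1 (hM' x)
      have h4 := abs_le.1 (hM' y)
      linarith
    · have : 0 ≤ 2 * M / δ * dist (φ x) (φ y) := by positivity
      linarith
  obtain ⟨M, hM⟩ := isCompact_univ.exists_bound_of_continuousOn hu.continuousOn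
  have hbdd : ∀ p, BddBelow (range fun x => u x + N * dist p (φ x)) := fun p => by
    refine ⟨-M, ?_⟩
    rintro _ ⟨x, rfl⟩
    have := (abs_le.1 (hM x (mem_univ x))).1
    have : 0 ≤ (N : ℝ) * dist p (φ x) := by positivity
    simp only
    linarith
  -- The McShane extension formula; the slack `ε` in the choice of `N` becomes the approximation
  -- error.
  refine ⟨N, fun p => ⨅ x, (u x + N * dist p (φ x)), ?_, fun x => ?_⟩
  · refine LipschitzWith.of_le_add_mul N fun p q => ?_
    rw [← sub_le_iff_le_add]
    refine le_ciInf fun x => ?_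
    have h1 := ciInf_le (hbdd p) x
    have h2 : (N : ℝ) * dist p (φ x) ≤ N * (dist p q + dist q (φ x)) := by
      gcongr
      exact dist_triangle _ _ _
    linarith
  · rw [abs_le]
    constructor
    · have : u x - ε ≤ ⨅ y, (u y + N * dist (φ x) (φ y)) :=
        le_ciInf fun y => by have := hN x y; linarith
      linarith
    · have := ciInf_le (hbdd (φ x)) x
      simp only [dist_self, mul_zero, add_zero] at this
      linarith

end Inverse

/-! ### Kernels of derivatives under Lipschitz composition -/

section Kernel

variable {E F G : Type*} [NormedAddCommGroup E] [NormedSpace ℝ E] [NormedAddCommGroup F]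
  [NormedSpace ℝ F] [NormedAddCommGroup G] [NormedSpace ℝ G]

/-- A direction annihilated by the derivative of `f` is annihilated by the derivative of every
function that locally is a Lipschitz function of `f`. -/
lemma fderiv_comp_lipschitz_apply_eq_zero {f : E → F} {τ : F → G} {g : E → G} {K : ℝ≥0}
    (hτ : LipschitzWith K τ) {x v : E} (hg : DifferentiableAt ℝ g x)
    (hf : DifferentiableAt ℝ f x) (heq : g =ᶠ[𝓝 x] τ ∘ f) (hv : fderiv ℝ f x v = 0) :
    fderiv ℝ g x v = 0 := by
  have h1 : Tendsto (fun r : ℝ => r⁻¹ • (f (x + r • v) - f x)) (𝓝[≠] 0) (𝓝 0) := hv ▸ (hf.hasFDerivAt.hasLineDerivAt v).tendsto_slope_zero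
  have h2 : Tendsto (fun r : ℝ => r⁻¹ • (g (x + r • v) - g x)) (𝓝[≠] 0) (𝓝 (fderiv ℝ g x v)) := 
    (hg.hasFDerivAt.hasLineDerivAt v).tendsto_slope_zero
  -- The chain rule is unavailable, since `τ` need not be differentiable at `f x`; instead the
  -- difference quotients of `g` are bounded by `K` times those of `f`.
  have h3 : Tendsto (fun r : ℝ => r⁻¹ • (g (x + r • v) - g x)) (𝓝[≠] 0) (𝓝 0) := by
    refine squeeze_zero_norm' ?_ (by simpa using (h1.norm.const_mul (K : ℝ)))
    have hc : Tendsto (fun r : ℝ => x + r • v) (𝓝[≠] 0) (𝓝 x) := by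
      have : Tendsto (fun r : ℝ => x + r • v) (𝓝 0) (𝓝 (x + (0 : ℝ) • v)) :=
        Continuous.tendsto (by fun_prop) 0
      rw [zero_smul, add_zero] at this
      exact this.mono_left nhdsWithin_le_nhds
    filter_upwards [hc.eventually heq] with r hr
    rw [hr, heq.self_of_nhds, norm_smul, norm_smul, mul_left_comm]
    gcongr
    simpa [dist_eq_norm] using hτ.dist_le_mul (f (x + r • v)) (f x)
  exact tendsto_nhds_unique h2 h3

end Kernel
-- The contact structure and the rank of Lipschitz maps
section Contact

variable {n : ℕ}

@[simp] lemma cx_sub (p q : Heis n) (j : Fin n) : cx (p - q) j = cx p j - cx q j := rfl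
@[simp] lemma cy_sub (p q : Heis n) (j : Fin n) : cy (p - q) j = cy p j - cy q j := rfl
@[simp] lemma cx_smul (r : ℝ) (p : Heis n) (j : Fin n) : cx (r • p) j = r * cx p j := rfl
@[simp] lemma cy_smul (r : ℝ) (p : Heis n) (j : Fin n) : cy (r • p) j = r * cy p j := rfl
@[simp] lemma ct_sub (p q : Heis n) : ct (p - q) = ct p - ct q := rfl
@[simp] lemma ct_smul (r : ℝ) (p : Heis n) : ct (r • p) = r * ct p := rfl

lemma continuous_cx (j : Fin n) : Continuous fun p : Heis n => cx p j := by
  unfold cx; fun_prop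
lemma continuous_cy (j : Fin n) : Continuous fun p : Heis n => cy p j := by
  unfold cy; fun_prop
lemma continuous_ct : Continuous fun p : Heis n => ct p := by
  unfold ct; fun_prop

/-- A property of all coordinates, from the properties of the named ones. -/
lemma forall_coord {P : Fin (2 * n + 1) → Prop} (hx : ∀ j : Fin n, P ⟨2 * j.1, by omega⟩)
    (hy : ∀ j : Fin n, P ⟨2 * j.1 + 1, by omega⟩) (ht : P (Fin.last (2 * n))) (i) : P i := by
  obtain ⟨i, hi⟩ := i
  rcases Nat.even_or_odd' i with ⟨k, rfl | rfl⟩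
  · rcases (show k ≤ n by omega).lt_or_eq with h | rfl
    · exact hx ⟨k, h⟩
    · exact ht
  · exact hy ⟨k, by omega⟩

/-- The symplectic form on the horizontal coordinates. -/
def hForm (p q : Heis n) : ℝ := ∑ j : Fin n, (cx p j * cy q j - cy p j * cx q j)

lemma hVert_eq (p q : Heis n) : hVert p q = ct p - ct q + 2 * hForm (p - q) q := by
  simp only [hVert, hForm, Matrix.det_fin_two_of, cx_sub, cy_sub]
  congr 3
  ext j
  ring

/-- The symplectic form measures the failure of the vertical part to be additive. This is how
smallness of vertical parts turns into isotropy. -/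
lemma hVert_eq_add (p q r : Heis n) :
    hVert p r = hVert p q + hVert q r - 2 * hForm (p - q) (q - r) := by
  rw [hVert_triangle p q r, hForm, sub_eq_add_neg, ← mul_neg, ← Finset.sum_neg_distrib]
  congr 3
  ext j
  simp only [cx_sub, cy_sub]
  ring

lemma hForm_smul (a b : ℝ) (p q : Heis n) : hForm (a • p) (b • q) = a * b * hForm p q := by
  simp only [hForm, cx_smul, cy_smul, Finset.mul_sum]
  exact Finset.sum_congr rfl fun j _ => by ring

lemma hForm_self (p : Heis n) : hForm p p = 0 :=
  Finset.sum_eq_zero fun j _ => by ring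

lemma continuous_hForm : Continuous fun z : Heis n × Heis n => hForm z.1 z.2 := by
  unfold hForm
  have := fun j => continuous_cx (n := n) j
  have := fun j => continuous_cy (n := n) j
  fun_prop

lemma hVert_swap (p q : Heis n) : hVert q p = -hVert p q := by
  rw [hVert_eq, hVert_eq]
  have : hForm (q - p) p = - hForm (p - q) q := by
    simp only [hForm, cx_sub, cy_sub, ← Finset.sum_neg_distrib]
    exact Finset.sum_congr rfl fun j _ => by ring
  rw [this]
  ring

lemma hDist_comm (p q : Heis n) : hDist p q = hDist q p := by
  simp only [hDist, hVert_swap p q, abs_neg, abs_sub_comm (q _)]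

lemma abs_cx_sub_le_hDist (p q : Heis n) (j : Fin n) : |cx p j - cx q j| ≤ hDist p q :=
  abs_sub_le_hDist p q ⟨2 * j.1, by omega⟩

lemma abs_cy_sub_le_hDist (p q : Heis n) (j : Fin n) : |cy p j - cy q j| ≤ hDist p q :=
  abs_sub_le_hDist p q ⟨2 * j.1 + 1, by omega⟩

lemma norm_le_of_abs_coord_le {m : ℕ} {p : EuclideanSpace ℝ (Fin m)} {c : ℝ} (hc : 0 ≤ c)
    (h : ∀ i, |p i| ≤ c) : ‖p‖ ≤ m * c := by
  refine le_of_pow_le_pow_left₀ two_ne_zero (by positivity) ?_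
  rw [EuclideanSpace.real_norm_sq_eq]
  calc ∑ i, p i ^ 2 ≤ ∑ _i : Fin m, c ^ 2 :=
        Finset.sum_le_sum fun i _ => sq_le_sq' (abs_le.1 (h i)).1 (abs_le.1 (h i)).2
    _ = m * c ^ 2 := by simp
    _ ≤ (m : ℝ) ^ 2 * c ^ 2 := by
        have : (m : ℝ) ≤ (m : ℝ) ^ 2 := by exact_mod_cast Nat.le_self_pow two_ne_zero m
        gcongr
    _ = _ := by ring

/-- The Euclidean distance is controlled by the Korányi distance on bounded sets. -/
lemma norm_sub_le_of_hDist_le {p q : Heis n} {M D : ℝ} (hM : 0 ≤ M) (hD : hDist p q ≤ D)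
    (hx : ∀ j, |cx q j| ≤ M) (hy : ∀ j, |cy q j| ≤ M) :
    ‖p - q‖ ≤ (2 * n + 1 : ℕ) * ((1 + D + 4 * n * M) * hDist p q) := by
  have hd := hDist_nonneg p q
  have hD0 := hd.trans hD
  have hle : hDist p q ≤ (1 + D + 4 * n * M) * hDist p q :=
    le_mul_of_one_le_left hd (by have : 0 ≤ 4 * n * M := by positivity
                                 linarith)
  refine norm_le_of_abs_coord_le (by positivity) (forall_coord (fun j => ?_) (fun j => ?_) ?_)
  · exact (abs_cx_sub_le_hDist p q j).trans hle
  · exact (abs_cy_sub_le_hDist p q j).trans hle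
  · have h1 := abs_hVert_le p q
    have h2 : |hForm (p - q) q| ≤ n * (2 * (hDist p q * M)) := by
      calc _ ≤ ∑ j : Fin n, |cx (p - q) j * cy q j - cy (p - q) j * cx q j| :=
            Finset.abs_sum_le_sum_abs _ _
        _ ≤ ∑ _j : Fin n, 2 * (hDist p q * M) := by
            refine Finset.sum_le_sum fun j _ => (abs_sub _ _).trans ?_
            rw [abs_mul, abs_mul, cx_sub, cy_sub]
            have := mul_le_mul (abs_cx_sub_le_hDist p q j) (hy j) (abs_nonneg _) hd
            have := mul_le_mul (abs_cy_sub_le_hDist p q j) (hx j) (abs_nonneg _) hd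
            linarith
        _ = _ := by simp
    have h3 : (p - q) (Fin.last (2 * n)) = hVert p q - 2 * hForm (p - q) q := by
      rw [hVert_eq]; show ct p - ct q = _; ring
    rw [h3]
    refine (abs_sub _ _).trans ?_
    rw [abs_mul, abs_two]
    nlinarith

/-- The comparison of the two distances depends on the size of the horizontal coordinates, hence the
bounded domain. The Euclidean Lipschitz bound is what Rademacher's theorem requires. -/
lemma IsLip.exists_lipschitzWith {X : Type*} [PseudoMetricSpace X] [BoundedSpace X]
    {f : X → Heis n} (hf : IsLip f) : ∃ K : ℝ≥0, LipschitzWith K f := by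
  rcases isEmpty_or_nonempty X with hX | ⟨⟨x₀⟩⟩
  · exact ⟨0, fun x => hX.elim x⟩
  obtain ⟨L, hL, h⟩ := hf
  obtain ⟨R, hR⟩ := (Bornology.IsBounded.all (univ : Set X)).subset_closedBall x₀
  have hR' : ∀ x, dist x x₀ ≤ R := fun x => hR (mem_univ x)
  have hR0 : 0 ≤ R := dist_nonneg.trans (hR' x₀)
  have hb : ∀ x (i : Fin (2 * n)), |f x i.castSucc| ≤ ‖f x₀‖ + L * R := fun x i => by
    have h1 := (abs_sub_le_hDist (f x) (f x₀) i).trans (h x x₀)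
    have h2 := mul_le_mul_of_nonneg_left (hR' x) hL
    have h3 : |f x₀ i.castSucc| ≤ ‖f x₀‖ := PiLp.norm_apply_le (f x₀) i.castSucc
    have h4 := abs_sub_abs_le_abs_sub (f x i.castSucc) (f x₀ i.castSucc)
    linarith
  have hD : ∀ x y, hDist (f x) (f y) ≤ L * (R + R) := fun x y =>
    (h x y).trans (mul_le_mul_of_nonneg_left
      ((dist_triangle_right x y x₀).trans (add_le_add (hR' x) (hR' y))) hL)
  have hM : 0 ≤ ‖f x₀‖ + L * R := by positivity
  refine ⟨((2 * n + 1 : ℕ) * ((1 + L * (R + R) + 4 * n * (‖f x₀‖ + L * R)) * L)).toNNReal,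
    LipschitzWith.of_dist_le_mul fun x y => ?_⟩
  rw [Real.coe_toNNReal _ (by positivity), dist_eq_norm]
  refine (norm_sub_le_of_hDist_le hM (hD x y) (fun j => hb y ⟨2 * j.1, by omega⟩)
    (fun j => hb y ⟨2 * j.1 + 1, by omega⟩)).trans ?_
  calc _ ≤ ((2 * n + 1 : ℕ) : ℝ) *
        ((1 + L * (R + R) + 4 * n * (‖f x₀‖ + L * R)) * (L * dist x y)) := by
        gcongr
        exact h x y
    _ = _ := by ring

variable {E : Type*} [NormedAddCommGroup E] [NormedSpace ℝ E]

/-! ### Blow-ups at a point of differentiability -/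

section Blowup

variable {f : E → Heis n} {L : ℝ} {p : E}

lemma tendsto_blowup (hp : DifferentiableAt ℝ f p) (a b : E) :
    Tendsto (fun r : ℝ => r⁻¹ • (f (p + r • a) - f (p + r • b))) (𝓝[≠] 0)
      (𝓝 (fderiv ℝ f p (a - b))) := by
  have h : ∀ v, Tendsto (fun r : ℝ => r⁻¹ • (f (p + r • v) - f p)) (𝓝[≠] 0)
      (𝓝 (fderiv ℝ f p v)) := fun v => 
    (hp.hasFDerivAt.hasLineDerivAt v).tendsto_slope_zero
  rw [map_sub]
  refine ((h a).sub (h b)).congr fun r => ?_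
  rw [← smul_sub, sub_sub_sub_cancel_right]

/-- At a point of differentiability the vertical parts of the blow-ups of a Lipschitz map
tend to zero. -/
lemma tendsto_hVert_blowup (hf : ∀ x y, hDist (f x) (f y) ≤ L * dist x y)
    (hp : DifferentiableAt ℝ f p) (a b : E) :
    Tendsto (fun r : ℝ => hVert (f (p + r • a)) (f (p + r • b)) / r ^ 2) (𝓝[≠] 0) (𝓝 0) := by
  -- Bisection: at the midpoint the symplectic defect tends to the form on two equal vectors, which
  -- is zero, so the vertical part is asymptotically additive. A bound quadratic in `‖a - b‖` then
  -- halves at each bisection, as `2 * (1/4) = 1/2`.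
  have key : ∀ (k : ℕ) (a b : E) (ε : ℝ), 0 < ε → ∀ᶠ r : ℝ in 𝓝[≠] 0,
      |hVert (f (p + r • a)) (f (p + r • b)) / r ^ 2| ≤ L ^ 2 * ‖a - b‖ ^ 2 / 2 ^ k + ε := by
    intro k
    induction k with
    | zero =>
      intro a b ε hε
      filter_upwards [self_mem_nhdsWithin] with r hr
      have hr0 : 0 < r ^ 2 := by positivity [show r ≠ 0 from hr]
      have h1 := abs_hVert_le (f (p + r • a)) (f (p + r • b))
      have h2 := pow_le_pow_left₀ (hDist_nonneg _ _) (hf (p + r • a) (p + r • b)) 2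
      have h3 : dist (p + r • a) (p + r • b) = |r| * ‖a - b‖ := by
        rw [dist_add_left, dist_smul₀, dist_eq_norm, Real.norm_eq_abs]
      rw [h3, mul_pow, mul_pow, sq_abs] at h2
      rw [abs_div, abs_of_pos hr0, div_le_iff₀ hr0, pow_zero, div_one]
      nlinarith
    | succ k ih =>
      intro a b ε hε
      set c := midpoint ℝ a b with hc
      have e1 : a - c = (1 / 2 : ℝ) • (a - b) := by
        rw [hc, midpoint_eq_smul_add, smul_add, smul_sub, invOf_eq_inv]
        module
      have e2 : c - b = (1 / 2 : ℝ) • (a - b) := by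
        rw [hc, midpoint_eq_smul_add, smul_add, smul_sub, invOf_eq_inv]
        module
      have hform : Tendsto (fun r : ℝ => hForm (r⁻¹ • (f (p + r • a) - f (p + r • c)))
          (r⁻¹ • (f (p + r • c) - f (p + r • b)))) (𝓝[≠] 0) (𝓝 0) := by
        have := (continuous_hForm.tendsto _).comp
          ((tendsto_blowup hp a c).prodMk_nhds (tendsto_blowup hp c b))
        rwa [e1, e2, hForm_self] at this
      have h1 := ih a c (ε / 4) (by positivity)
      have h2 := ih c b (ε / 4) (by positivity)
      have h3 := hform.abs.eventually_le_const (show |(0 : ℝ)| < ε / 4 by simpa using hε)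
      filter_upwards [h1, h2, h3, self_mem_nhdsWithin] with r h1 h2 h3 hr
      have hr' : r ≠ 0 := hr
      have n1 : ‖a - c‖ ^ 2 = ‖a - b‖ ^ 2 / 4 := by rw [e1, norm_smul]; norm_num; ring
      have n2 : ‖c - b‖ ^ 2 = ‖a - b‖ ^ 2 / 4 := by rw [e2, norm_smul]; norm_num; ring
      rw [n1] at h1
      rw [n2] at h2
      rw [hForm_smul] at h3
      have e3 : hVert (f (p + r • a)) (f (p + r • b)) / r ^ 2 =
          hVert (f (p + r • a)) (f (p + r • c)) / r ^ 2 +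
          hVert (f (p + r • c)) (f (p + r • b)) / r ^ 2 -
          2 * (r⁻¹ * r⁻¹ * hForm (f (p + r • a) - f (p + r • c))
            (f (p + r • c) - f (p + r • b))) := by
        rw [hVert_eq_add _ (f (p + r • c))]
        field_simp
      have e4 : L ^ 2 * ‖a - b‖ ^ 2 / 2 ^ (k + 1) = 2 * (L ^ 2 * (‖a - b‖ ^ 2 / 4) / 2 ^ k) := by
        rw [pow_succ]; ring
      rw [e3, e4]
      rw [abs_le] at h1 h2 h3 ⊢
      constructor <;> linarith
  rw [Metric.tendsto_nhds]
  intro ε hε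
  obtain ⟨k, hk⟩ : ∃ k : ℕ, L ^ 2 * ‖a - b‖ ^ 2 / 2 ^ k < ε / 2 := by
    have : Tendsto (fun k : ℕ => L ^ 2 * ‖a - b‖ ^ 2 / 2 ^ k) atTop (𝓝 0) :=
      tendsto_const_nhds.div_atTop (tendsto_pow_atTop_atTop_of_one_lt one_lt_two)
    exact (this.eventually_lt_const (half_pos hε)).exists
  filter_upwards [key k a b (ε / 2) (half_pos hε)] with r hr
  rw [dist_zero_right, Real.norm_eq_abs]
  linarith

/-- Apply `hVert_eq_add` to the images of `p + r u`, `p`, `p - r v` and divide by `r ^ 2`: the three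
vertical parts vanish in the limit and the symplectic term remains. -/
lemma hForm_fderiv_eq_zero (hf : ∀ x y, hDist (f x) (f y) ≤ L * dist x y)
    (hp : DifferentiableAt ℝ f p) (u v : E) :
    hForm (fderiv ℝ f p u) (fderiv ℝ f p v) = 0 := by
  have h1 := (continuous_hForm.tendsto _).comp
    ((tendsto_blowup hp u 0).prodMk_nhds (tendsto_blowup hp 0 (-v)))
  rw [sub_zero, zero_sub, neg_neg] at h1
  have h2 := ((tendsto_hVert_blowup hf hp u 0).add (tendsto_hVert_blowup hf hp 0 (-v))).sub
    (tendsto_hVert_blowup hf hp u (-v))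
  have h3 := h2.div_const 2
  norm_num only at h3
  refine tendsto_nhds_unique (h1.congr' ?_) h3
  filter_upwards [self_mem_nhdsWithin] with r hr
  have hr' : r ≠ 0 := hr
  simp only [Function.comp_apply]
  rw [hForm_smul, hVert_eq_add (f (p + r • u)) (f (p + r • (0 : E))) (f (p + r • -v))]
  field_simp
  ring

/-- Dividing the formula for the vertical part by `r` gives the contact equation `ct (Df v) = -2 *
hForm (Df v) (f p)`, whose right side involves only the horizontal coordinates of `Df v`. -/
lemma fderiv_apply_eq_zero_of_horizontal (hf : ∀ x y, hDist (f x) (f y) ≤ L * dist x y)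
    (hp : DifferentiableAt ℝ f p) {v : E} (hx : ∀ j, cx (fderiv ℝ f p v) j = 0)
    (hy : ∀ j, cy (fderiv ℝ f p v) j = 0) : fderiv ℝ f p v = 0 := by
  have ht : ct (fderiv ℝ f p v) = 0 := by
    have hb := tendsto_blowup hp v 0
    rw [sub_zero] at hb
    have h1 := (continuous_ct.tendsto _).comp hb
    have h2 := (continuous_hForm.tendsto _).comp
      (hb.prodMk_nhds (tendsto_const_nhds (x := f p)))
    have h0 : hForm (fderiv ℝ f p v) (f p) = 0 :=
      Finset.sum_eq_zero fun j _ => by rw [hx, hy]; ring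
    have hid : Tendsto (fun r : ℝ => r) (𝓝[≠] 0) (𝓝 0) := tendsto_id.mono_left nhdsWithin_le_nhds
    have h3 := (hid.mul (tendsto_hVert_blowup hf hp v 0)).sub (h2.const_mul 2)
    simp only [h0, mul_zero, sub_zero] at h3
    refine tendsto_nhds_unique (h1.congr' ?_) h3
    filter_upwards [self_mem_nhdsWithin] with r hr
    have hr' : r ≠ 0 := hr
    have h4 := hForm_smul r⁻¹ 1 (f (p + r • v) - f p) (f p)
    rw [one_smul, mul_one] at h4
    simp only [Function.comp_apply, smul_zero, add_zero, ct_smul, ct_sub]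
    rw [h4, hVert_eq]
    field_simp
    ring
  ext i
  exact forall_coord (P := fun i => fderiv ℝ f p v i = 0) hx hy ht i

end Blowup

/-- The horizontal coordinates as linear maps. -/
def cxLin (n : ℕ) : Heis n →ₗ[ℝ] Fin n → ℝ where
  toFun p j := cx p j
  map_add' _ _ := rfl
  map_smul' _ _ := rfl

def cyLin (n : ℕ) : Heis n →ₗ[ℝ] Fin n → ℝ where
  toFun p j := cy p j
  map_add' _ _ := rfl
  map_smul' _ _ := rfl

/-- An isotropic linear map from a space of dimension greater than `n` is not injective. -/
lemma exists_horizontal_kernel [FiniteDimensional ℝ E] (hE : n < Module.finrank ℝ E)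
    (A : E →ₗ[ℝ] Heis n) (hA : ∀ u v, hForm (A u) (A v) = 0) :
    ∃ v ≠ 0, (∀ j, cx (A v) j = 0) ∧ ∀ j, cy (A v) j = 0 := by
  let X : E →ₗ[ℝ] Fin n → ℝ := cxLin n ∘ₗ A
  let Y : E →ₗ[ℝ] Fin n → ℝ := cyLin n ∘ₗ A
  -- This is `(X + iY)(u + iv)` in real and imaginary parts, a map from real dimension `2 dim E` to
  -- `2n`. On its kernel the form of `A u` and `A v` equals the squared horizontal length of `A u`,
  -- so isotropy kills the horizontal parts of both.
  let T : E × E →ₗ[ℝ] (Fin n → ℝ) × (Fin n → ℝ) :=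
    (X.coprod (-Y)).prod (Y.coprod X)
  have hT : LinearMap.ker T ≠ ⊥ := LinearMap.ker_ne_bot_of_finrank_lt (by simp; omega)
  obtain ⟨⟨u, v⟩, huv, hne⟩ := (Submodule.ne_bot_iff _).1 hT
  have h1 : ∀ j, cx (A u) j = cy (A v) j := fun j => by
    have := congrFun (congrArg Prod.fst (LinearMap.mem_ker.1 huv)) j
    have h2 : cx (A u) j + -cy (A v) j = 0 := by
      show X u j + -Y v j = 0
      simpa [T] using this
    linarith
  have h2 : ∀ j, cy (A u) j = -cx (A v) j := fun j => by
    have := congrFun (congrArg Prod.snd (LinearMap.mem_ker.1 huv)) j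
    have h2 : cy (A u) j + cx (A v) j = 0 := by
      show Y u j + X v j = 0
      simpa [T] using this
    linarith
  have h3 : ∑ j, (cx (A u) j ^ 2 + cy (A u) j ^ 2) = 0 := by
    rw [← hA u v, hForm]
    refine Finset.sum_congr rfl fun j _ => ?_
    rw [← h1]
    linear_combination cy (A u) j * h2 j
  have h4 : ∀ j, cx (A u) j ^ 2 + cy (A u) j ^ 2 = 0 := fun j =>
    (Finset.sum_eq_zero_iff_of_nonneg fun i _ => by positivity).1 h3 j (Finset.mem_univ j)
  have h5 : ∀ j, cx (A u) j = 0 := fun j => by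
    have := h4 j
    exact pow_eq_zero_iff two_ne_zero |>.1
      (by nlinarith [sq_nonneg (cx (A u) j), sq_nonneg (cy (A u) j)])
  have h6 : ∀ j, cy (A u) j = 0 := fun j => by
    have := h4 j
    exact pow_eq_zero_iff two_ne_zero |>.1
      (by nlinarith [sq_nonneg (cx (A u) j), sq_nonneg (cy (A u) j)])
  by_cases hu : u = 0
  · refine ⟨v, fun hv => hne (by rw [hu, hv]; rfl), fun j => ?_, fun j => ?_⟩
    · have := h2 j; rw [h6] at this; linarith
    · rw [← h1, h5]
  · exact ⟨u, hu, h5, h6⟩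

/-- The derivative of a Lipschitz map into the Heisenberg group has rank at most `n`. -/
theorem exists_ne_zero_fderiv_apply_eq_zero [FiniteDimensional ℝ E]
    (hE : n < Module.finrank ℝ E) {f : E → Heis n} (hf : IsLip f) {p : E}
    (hp : DifferentiableAt ℝ f p) : ∃ v ≠ 0, fderiv ℝ f p v = 0 := by
  obtain ⟨L, -, hL⟩ := hf
  obtain ⟨v, hv, hx, hy⟩ := exists_horizontal_kernel hE (fderiv ℝ f p : E →ₗ[ℝ] Heis n)
    (hForm_fderiv_eq_zero hL hp)
  exact ⟨v, hv, fderiv_apply_eq_zero_of_horizontal hL hp hx hy⟩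

end Contact
-- Singular maps cannot be close to the identity on the sphere
section NoRetraction

lemma det_eq_zero_of_apply_eq_zero {E : Type*} [NormedAddCommGroup E] [NormedSpace ℝ E]
    [FiniteDimensional ℝ E] {A : E →L[ℝ] E} {v : E} (hv : v ≠ 0) (h : A v = 0) : A.det = 0 := by
  by_contra hA
  refine hv ((A.toContinuousLinearEquivOfDetNeZero hA).injective ?_)
  rw [map_zero, ContinuousLinearMap.toContinuousLinearEquivOfDetNeZero_apply, h]

variable {E : Type*} [NormedAddCommGroup E] [InnerProductSpace ℝ E] [FiniteDimensional ℝ E]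

/-- An invertible derivative would take some `v` to `h x`, and `‖h‖ ^ 2` would have derivative `2 *
c ^ 2` along `v` although it is constant near `x`. -/
lemma det_fderiv_eq_zero_of_norm_eq {h : E → E} {x : E} {c : ℝ} (hc : c ≠ 0)
    (hd : DifferentiableAt ℝ h x) (hn : ∀ᶠ y in 𝓝 x, ‖h y‖ = c) : (fderiv ℝ h x).det = 0 := by
  by_contra hA
  obtain ⟨v, hv⟩ := ((fderiv ℝ h x).toContinuousLinearEquivOfDetNeZero hA).surjective (h x)
  rw [ContinuousLinearMap.toContinuousLinearEquivOfDetNeZero_apply] at hv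
  have h1 := hd.hasFDerivAt.norm_sq
  have h2 : HasFDerivAt (fun y => ‖h y‖ ^ 2) (0 : E →L[ℝ] ℝ) x :=
    (hasFDerivAt_const (c ^ 2) x).congr_of_eventuallyEq (hn.mono fun y hy => by simp only [hy])
  have h3 := congrArg (fun A : E →L[ℝ] ℝ => A v) (h1.unique h2)
  simp [hv, hn.self_of_nhds, hc] at h3

variable [MeasurableSpace E] [BorelSpace E] {F : Type*} [NormedAddCommGroup F] [NormedSpace ℝ F]
  [FiniteDimensional ℝ F]

/-- Let `f` be a Lipschitz map from the unit ball (extended radially to the whole space) whose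
derivative is nowhere injective. Then `f` followed by a Lipschitz map cannot be close to the
identity on the unit sphere. -/
theorem false_of_singular_of_near_id {f : E → F} {ψ : F → E} {K N : ℝ≥0}
    (hf : LipschitzWith K f) (hψ : LipschitzWith N ψ)
    (hsing : ∀ x, DifferentiableAt ℝ f x → ∃ v ≠ 0, fderiv ℝ f x v = 0)
    (hrad : ∀ x, f (radial 1 x) = f x) (hnear : ∀ x, ‖x‖ = 1 → ‖ψ (f x) - x‖ ≤ 1 / 2) :
    False := by
  -- `s` rises from `0` on the unit ball to `1` at radius `2`, so `G₀` passes from `ψ ∘ f` to the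
  -- identity across the shell. On the ball of radius `2`, `x + g x` is the radial projection of
  -- `G₀`, scaled by `2`. The truncation `q` of the identity keeps the products bounded, hence
  -- Lipschitz.
  let s : E → ℝ := fun x => max 0 (min 1 (‖x‖ - 1))
  let q : E → E := fun x => (2 : ℝ) • radial 2 x
  let G₀ : E → E := fun x => (1 - s x) • ψ (f x) + s x • q x
  let g : E → E := fun x => (2 : ℝ) • radial (1 / 2) (G₀ x) - q x
  have hs0 : ∀ x, 0 ≤ s x := fun x => le_max_left _ _
  have hs1 : ∀ x, s x ≤ 1 := fun x => max_le zero_le_one (min_le_left _ _)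
  have hsL : LipschitzWith 1 s := by
    have h1 : LipschitzWith 1 fun x : E => ‖x‖ - 1 := by
      simpa using lipschitzWith_one_norm.sub (LipschitzWith.const (1 : ℝ))
    exact (h1.const_min 1).const_max 0
  have hsL' : LipschitzWith 1 fun x => 1 - s x := by
    simpa using (LipschitzWith.const (1 : ℝ)).sub hsL
  have hqL : LipschitzWith (‖(2 : ℝ)‖₊ * (2 / 2 : ℝ).toNNReal) q :=
    (lipschitzWith_smul (2 : ℝ)).comp (lipschitzWith_radial two_pos)
  have hq2 : ∀ x, ‖q x‖ ≤ (2 : ℝ≥0) := fun x => by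
    simp only [q, norm_smul, Real.norm_ofNat, NNReal.coe_ofNat]
    linarith [norm_radial_le two_pos x]
  have hq : ∀ x : E, ‖x‖ ≤ 2 → q x = x := fun x hx => smul_radial_of_le two_pos hx
  have hFL : LipschitzWith (N * K) fun x => ψ (f x) := hψ.comp hf
  have hFb : ∀ x, ‖ψ (f x)‖ ≤ (‖ψ (f 0)‖₊ + N * K : ℝ≥0) := fun x => by
    have h1 := hFL.dist_le_mul (radial 1 x) 0
    simp only [hrad, dist_zero_right] at h1
    have h2 := mul_le_mul_of_nonneg_left (norm_radial_le one_pos x) (N * K).coe_nonneg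
    have h3 := norm_le_norm_add_norm_sub' (ψ (f x)) (ψ (f 0))
    rw [← dist_eq_norm] at h3
    rw [NNReal.coe_add, coe_nnnorm]
    linarith
  obtain ⟨M, hgL⟩ : ∃ M, LipschitzWith M g := by
    have h1 := lipschitz_smul_of_bounded hsL' hFL (a := 1)
      (fun x => by rw [abs_of_nonneg (sub_nonneg.2 (hs1 x))]; simpa using hs0 x) hFb
    have h2 := lipschitz_smul_of_bounded hsL hqL (a := 1)
      (fun x => by rw [abs_of_nonneg (hs0 x)]; exact hs1 x) hq2
    exact ⟨_, ((lipschitzWith_smul (2 : ℝ)).comp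
      ((lipschitzWith_radial (by norm_num)).comp (h1.add h2))).sub hqL⟩
  have hg0 : ∀ x, 2 ≤ ‖x‖ → g x = 0 := fun x hx => by
    have e1 : s x = 1 := by
      simp only [s]
      rw [min_eq_left (by linarith), max_eq_right zero_le_one]
    have e2 : ‖q x‖ = 2 := by
      simp only [q, norm_smul, norm_radial_eq two_pos hx, Real.norm_ofNat, mul_one]
    have e3 := norm_smul_radial (c := 1 / 2) (by norm_num) (x := q x) (by rw [e2]; norm_num)
    rw [e2] at e3
    simp only [g, G₀, e1, sub_self, zero_smul, one_smul, zero_add, e3]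
  refine not_ae_det_eq_zero_of_eq_id_off_ball hgL two_pos hg0 ?_
  have hsph : ∀ r : ℝ, 0 < r → ∀ᵐ x ∂(μH[Module.finrank ℝ E] : Measure E), ‖x‖ ≠ r := by
    intro r hr
    have := Measure.addHaar_sphere_of_ne_zero (μH[Module.finrank ℝ E] : Measure E) 0 hr.ne'
    refine measure_mono_null (fun x hx => ?_) this
    simpa using hx
  filter_upwards [hsph 1 one_pos, hsph 2 two_pos, hf.ae_differentiableAt, hgL.ae_differentiableAt]
    with x hx1 hx2 hfx hgx hxB
  have hx2' : ‖x‖ < 2 := lt_of_le_of_ne (by simpa using hxB) hx2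
  have hd : DifferentiableAt ℝ (fun y => y + g y) x := differentiableAt_id.add hgx
  have hfd : fderiv ℝ (fun y => y + g y) x = ContinuousLinearMap.id ℝ E + fderiv ℝ g x :=
    ((hasFDerivAt_id x).add hgx.hasFDerivAt).fderiv
  rw [← hfd]
  have hlt2 : ∀ᶠ y in 𝓝 x, ‖y‖ < 2 := continuous_norm.continuousAt.eventually_lt_const hx2'
  rcases lt_or_gt_of_ne hx1 with hlt | hgt
  · obtain ⟨v, hv, hfv⟩ := hsing x hfx
    have hτ : LipschitzWith _ fun p => (2 : ℝ) • radial (1 / 2) (ψ p) :=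
      (lipschitzWith_smul (2 : ℝ)).comp ((lipschitzWith_radial (by norm_num)).comp hψ)
    refine det_eq_zero_of_apply_eq_zero hv
      (fderiv_comp_lipschitz_apply_eq_zero hτ hd hfx ?_ hfv)
    filter_upwards [continuous_norm.continuousAt.eventually_lt_const hlt, hlt2] with y hy hy2
    have e1 : s y = 0 := max_eq_left ((min_le_right _ _).trans (by linarith))
    simp only [g, G₀, e1, hq y hy2.le, sub_zero, one_smul, zero_smul, add_zero,
      Function.comp_apply, add_sub_cancel]
  · refine det_fderiv_eq_zero_of_norm_eq two_ne_zero hd ?_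
    filter_upwards [continuous_norm.continuousAt.eventually_const_lt hgt, hlt2] with y hy hy2
    have hG : 1 / 2 ≤ ‖G₀ y‖ := by
      have e1 : ‖radial 1 y‖ = 1 := norm_radial_eq one_pos hy.le
      have e2 := hnear _ e1
      rw [hrad] at e2
      -- The first term has norm at least `1` and the second at most `1/2`. So `G₀` stays outside
      -- the radius below which `radial (1 / 2)` no longer has norm one.
      have e3 : G₀ y = ((1 - s y) + s y * ‖y‖) • radial 1 y +
          (1 - s y) • (ψ (f y) - radial 1 y) := by
        have := norm_smul_radial one_pos hy.le
        simp only [G₀, hq y hy2.le]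
        rw [add_smul, mul_smul, this, smul_sub]
        abel
      have e4 := norm_sub_le_norm_add (((1 - s y) + s y * ‖y‖) • radial 1 y)
        ((1 - s y) • (ψ (f y) - radial 1 y))
      rw [← e3, norm_smul, norm_smul, e1, Real.norm_of_nonneg (sub_nonneg.2 (hs1 y)),
        Real.norm_of_nonneg (add_nonneg (sub_nonneg.2 (hs1 y))
          (mul_nonneg (hs0 y) (norm_nonneg y)))] at e4
      nlinarith [mul_le_mul_of_nonneg_left e2 (sub_nonneg.2 (hs1 y)), hs0 y,
        mul_le_mul_of_nonneg_left hy.le (hs0 y)]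
    simp only [g, hq y hy2.le, add_sub_cancel, norm_smul, Real.norm_ofNat,
      norm_radial_eq (by norm_num : (0 : ℝ) < 1 / 2) hG, mul_one]

end NoRetraction

/-! ### Non-extension, nontrivial classes and open sets -/

variable {n : ℕ}

lemma exists_lipschitz_left_inverse_near {φ : USphere n → Heis n} (hφ : IsLipEmbedding φ) :
    ∃ (N : ℝ≥0) (ψ : Heis n → EuclideanSpace ℝ (Fin (n + 1))), LipschitzWith N ψ ∧
      ∀ x, ‖ψ (φ x) - x.1‖ ≤ 1 / 2 := by
  obtain ⟨K, hK⟩ := hφ.1.exists_lipschitzWith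
  have hne : Nonempty (USphere n) := (NormedSpace.sphere_nonempty.2 zero_le_one).to_subtype
  choose N ψ hψ hnear using fun i : Fin (n + 1) =>
    -- Passing from coordinates to the norm costs a factor `n + 1`, so this tolerance gives `1/2`.
    exists_lipschitz_near_of_injective hK.continuous hφ.2 (u := fun x : USphere n => x.1 i)
      (by fun_prop) (ε := 1 / (2 * (n + 1 : ℕ))) (by positivity)
  refine ⟨(n + 1 : ℕ) * ∑ i, N i, fun p => WithLp.toLp 2 fun i => ψ i p,
    LipschitzWith.of_dist_le_mul fun p q => ?_, fun x => ?_⟩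
  · rw [dist_eq_norm, NNReal.coe_mul, NNReal.coe_natCast, mul_assoc]
    refine norm_le_of_abs_coord_le (by positivity) fun i => ((hψ i).dist_le_mul p q).trans ?_
    gcongr
    exact Finset.single_le_sum (fun _ _ => zero_le) (Finset.mem_univ i)
  · refine (norm_le_of_abs_coord_le (by positivity) fun i => hnear i x).trans (le_of_eq ?_)
    field_simp

/-- A Lipschitz embedding of the sphere has no Lipschitz extension to the ball. -/
theorem not_exists_lipschitz_extension {φ : USphere n → Heis n} (hφ : IsLipEmbedding φ) :
    ¬ ∃ Φ : UBall (n + 1) → Heis n, IsLip Φ ∧ ∀ x, Φ (sphereIncl x) = φ x := by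
  rintro ⟨Φ, hΦ, hext⟩
  obtain ⟨N, ψ, hψ, hnear⟩ := exists_lipschitz_left_inverse_near hφ
  obtain ⟨K, hK⟩ := hΦ.exists_lipschitzWith
  have hret : LipschitzWith 2
      (ballRetraction : EuclideanSpace ℝ (Fin (n + 1)) → UBall (n + 1)) :=
    LipschitzWith.of_dist_le_mul dist_ballRetraction_le
  have hf : IsLip fun x : EuclideanSpace ℝ (Fin (n + 1)) => Φ (ballRetraction x) := by
    obtain ⟨L, hL, h⟩ := hΦ
    refine ⟨L * 2, by positivity, fun x y => (h _ _).trans ?_⟩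
    rw [mul_assoc]
    gcongr
    exact dist_ballRetraction_le x y
  refine false_of_singular_of_near_id (hK.comp hret) hψ
    (fun x hx => exists_ne_zero_fderiv_apply_eq_zero (by simp) hf hx) (fun x => ?_) fun x hx => ?_
  · have : ballRetraction (radial 1 x) = ballRetraction x := Subtype.ext <| by
      have := smul_radial_of_le one_pos (norm_radial_le one_pos x)
      rwa [one_smul] at this
    rw [Function.comp_apply, Function.comp_apply, this]
  · have : ballRetraction x = sphereIncl ⟨x, by simpa using hx⟩ := Subtype.ext <| by
      have := smul_radial_of_le one_pos hx.le
      rwa [one_smul] at this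
    rw [Function.comp_apply, this, hext]
    exact hnear ⟨x, by simpa using hx⟩

/-- A Lipschitz null homotopy gives a Lipschitz extension to the ball. -/
lemma exists_extension_of_lipHomotopic_const {k : ℕ} {φ : LipMap k n} {c : Heis n}
    (h : LipHomotopic φ (constMap k c)) :
    ∃ Φ : UBall (k + 1) → Heis n, IsLip Φ ∧ ∀ x, Φ (sphereIncl x) = φ.1 x := by
  obtain ⟨H, ⟨L, hL, hH⟩, h0, h1⟩ := h
  have h2 : (0 : ℝ) < 1 / 2 := by norm_num
  -- The homotopy runs from time `0` on the sphere to time `1` at radius `1/2`; the inner ball goes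
  -- to `c`, which keeps the radial projection Lipschitz.
  let σ : UBall (k + 1) → unitInterval := fun x => projIcc 0 1 zero_le_one (2 - 2 * ‖x.1‖)
  have hσ : ∀ x y, dist (σ x) (σ y) ≤ 2 * dist x y := fun x y => by
    rw [Subtype.dist_eq, Real.dist_eq]
    refine (abs_projIcc_sub_projIcc zero_le_one).trans ?_
    have h3 := abs_norm_sub_norm_le y.1 x.1
    rw [← dist_eq_norm, dist_comm] at h3
    rw [sub_sub_sub_cancel_left, ← mul_sub, abs_mul, abs_two]
    gcongr
    exact h3
  let Φ : UBall (k + 1) → Heis n := fun x => if hx : 1 / 2 ≤ ‖x.1‖ then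
    H (σ x, ⟨radial (1 / 2) x.1, by simpa using norm_radial_eq h2 hx⟩) else c
  have hmix : ∀ x y : UBall (k + 1), 1 / 2 ≤ ‖x.1‖ → ¬ 1 / 2 ≤ ‖y.1‖ →
      hDist (Φ x) (Φ y) ≤ 4 * L * dist x y := by
    intro x y hx hy
    have hσy : σ y = 1 := projIcc_of_right_le _ (by linarith)
    simp only [Φ, dif_pos hx, dif_neg hy]
    -- Writing `c` as the value at time `1` over the same point of the sphere leaves only the time
    -- difference to estimate.
    rw [← show H (1, ⟨radial (1 / 2) x.1, by simpa using norm_radial_eq h2 hx⟩) = c from h1 _]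
    refine (hH _ _).trans ?_
    have h4 := hσ x y
    rw [hσy] at h4
    rw [Prod.dist_eq, dist_self, max_eq_left dist_nonneg]
    have : 0 ≤ L * dist x y := by positivity
    nlinarith
  refine ⟨Φ, ⟨4 * L, by positivity, fun x y => ?_⟩, fun x => ?_⟩
  · by_cases hx : 1 / 2 ≤ ‖x.1‖ <;> by_cases hy : 1 / 2 ≤ ‖y.1‖
    · simp only [Φ, dif_pos hx, dif_pos hy]
      refine (hH _ _).trans ?_
      rw [mul_comm 4 L, mul_assoc]
      gcongr
      rw [Prod.dist_eq]
      refine max_le ((hσ x y).trans (by linarith [dist_nonneg (x := x) (y := y)])) ?_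
      have := (lipschitzWith_radial h2).dist_le_mul x.1 y.1
      rw [Real.coe_toNNReal _ (by norm_num)] at this
      refine this.trans (le_of_eq ?_)
      norm_num [Subtype.dist_eq]
    · exact hmix x y hx hy
    · rw [hDist_comm, dist_comm]
      exact hmix y x hy hx
    · simp only [Φ, dif_neg hx, dif_neg hy, hDist_self]
      positivity
  · have hx : ‖x.1‖ = 1 := by simp
    have hx' : 1 / 2 ≤ ‖(sphereIncl x).1‖ := by
      show 1 / 2 ≤ ‖x.1‖
      rw [hx]; norm_num
    simp only [Φ, dif_pos hx']
    rw [← h0]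
    congr 2
    · refine projIcc_of_le_left _ ?_
      show 2 - 2 * ‖x.1‖ ≤ 0
      rw [hx]; norm_num
    · refine Subtype.ext ?_
      have := norm_smul_radial h2 hx'
      rw [show ‖(sphereIncl x).1‖ = 1 from hx, one_smul] at this
      exact this

theorem lipClass_ne_const {φ : LipMap n n} (hφ : IsLipEmbedding φ.1) (c : Heis n) :
    lipClass φ ≠ lipClass (constMap n c) := fun h =>
  not_exists_lipschitz_extension hφ (exists_extension_of_lipHomotopic_const (Quotient.exact h))

/-- `Ω` contains a small affine copy of the `(n+1)`-ball. An injective Lipschitz map restricts to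
its boundary as an embedding and to the ball as a forbidden extension. -/
theorem not_exists_injective_lipschitz {k : ℕ} (hk : n + 1 ≤ k)
    {Ω : Set (EuclideanSpace ℝ (Fin k))} (hΩ : IsOpen Ω) (hne : Ω.Nonempty) :
    ¬ ∃ f : Ω → Heis n, IsLip f ∧ Function.Injective f := by
  rintro ⟨f, ⟨L, hL, hf⟩, hinj⟩
  obtain ⟨p, hp⟩ := hne
  obtain ⟨r, hr, hball⟩ := Metric.isOpen_iff.1 hΩ p hp
  have hk0 : (0 : ℝ) < k := by exact_mod_cast (show 0 < k by omega)
  -- The coordinatewise norm bound costs a factor `k`, so the copy lies within `r / 2` of `p`.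
  set δ := r / (2 * k) with hδ
  have hδ0 : 0 < δ := by positivity
  let e : EuclideanSpace ℝ (Fin (n + 1)) → EuclideanSpace ℝ (Fin k) := fun x =>
    WithLp.toLp 2 fun i => p i + δ * if h : i.1 < n + 1 then x ⟨i.1, h⟩ else 0
  have he : ∀ x y, dist (e x) (e y) ≤ k * (δ * dist x y) := fun x y => by
    rw [dist_eq_norm]
    refine norm_le_of_abs_coord_le (by positivity) fun i => ?_
    have h1 : (e x - e y) i = δ * if h : i.1 < n + 1 then (x - y) ⟨i.1, h⟩ else 0 := by
      simp only [e, PiLp.sub_apply]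
      split_ifs <;> ring
    rw [h1, abs_mul, abs_of_pos hδ0, dist_eq_norm]
    gcongr
    split_ifs
    · exact PiLp.norm_apply_le (x - y) _
    · simp
  have hinj_e : Function.Injective e := fun x y hxy => by
    ext i
    have h1 := congrArg (fun z : EuclideanSpace ℝ (Fin k) => z ⟨i.1, by omega⟩) hxy
    simpa [e, hδ0.ne', i.2] using h1
  have hmem : ∀ x : UBall (n + 1), e x.1 ∈ Ω := fun x => hball <| by
    have h1 := he x.1 0
    have h2 : e 0 = p := by ext i; simp [e]
    have h3 : ‖x.1‖ ≤ 1 := mem_closedBall_zero_iff.1 x.2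
    rw [h2, dist_zero_right] at h1
    rw [mem_ball]
    calc dist (e x.1) p ≤ k * (δ * ‖x.1‖) := h1
      _ ≤ k * (δ * 1) := by gcongr
      _ = r / 2 := by rw [hδ]; field_simp
      _ < r := half_lt_self hr
  let Φ : UBall (n + 1) → Heis n := fun x => f ⟨e x.1, hmem x⟩
  have hΦ : ∀ x y, hDist (Φ x) (Φ y) ≤ L * (k * δ) * dist x y := fun x y => by
    refine (hf _ _).trans ?_
    rw [mul_assoc, mul_assoc]
    exact mul_le_mul_of_nonneg_left (he x.1 y.1) hL
  have hC : 0 ≤ L * (k * δ) := by positivity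
  refine not_exists_lipschitz_extension (φ := fun x => Φ (sphereIncl x))
    ⟨⟨_, hC, fun x y => hΦ (sphereIncl x) (sphereIncl y)⟩, fun x y hxy => ?_⟩
    ⟨Φ, ⟨_, hC, hΦ⟩, fun _ => rfl⟩
  exact Subtype.ext (hinj_e (congrArg Subtype.val (hinj hxy)))

/-! ### A bi-Lipschitz Legendrian sphere -/

variable {n : ℕ}

/-- The horizontal lift of the Whitney immersion `(x₀, x) ↦ (x, x₀ x)`. -/
noncomputable def whitney (x : USphere n) : Heis n :=
  WithLp.toLp 2 fun i => if h : i.1 < 2 * n then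
    (if i.1 % 2 = 0 then x.1 ⟨i.1 / 2 + 1, by omega⟩ else x.1 0 * x.1 ⟨i.1 / 2 + 1, by omega⟩)
    else 2 * (x.1 0 - x.1 0 ^ 3 / 3)

lemma cx_whitney (x : USphere n) (j : Fin n) : cx (whitney x) j = x.1 j.succ := by
  have h1 : 2 * j.1 < 2 * n := by omega
  simp only [cx, whitney, h1, ↓reduceDIte, Nat.mul_mod_right, if_true]
  refine congrArg x.1 (Fin.ext ?_)
  show 2 * j.1 / 2 + 1 = j.1 + 1
  omega

lemma cy_whitney (x : USphere n) (j : Fin n) : cy (whitney x) j = x.1 0 * x.1 j.succ := by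
  have h1 : 2 * j.1 + 1 < 2 * n := by omega
  have h2 : (2 * j.1 + 1) % 2 = 1 := by omega
  simp only [cy, whitney, h1, ↓reduceDIte, h2, one_ne_zero, if_false]
  refine congrArg (x.1 0 * x.1 ·) (Fin.ext ?_)
  show (2 * j.1 + 1) / 2 + 1 = j.1 + 1
  omega

lemma ct_whitney (x : USphere n) : ct (whitney x) = 2 * (x.1 0 - x.1 0 ^ 3 / 3) := by
  simp [ct, whitney]

lemma sq_add_sum_sq_eq_one (x : USphere n) : x.1 0 ^ 2 + ∑ j : Fin n, x.1 j.succ ^ 2 = 1 := by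
  have h : ‖x.1‖ = 1 := by simp
  rw [← Fin.sum_univ_succ (fun i => x.1 i ^ 2), ← EuclideanSpace.real_norm_sq_eq, h, one_pow]

lemma dist_sq_eq (x y : USphere n) :
    dist x y ^ 2 = (x.1 0 - y.1 0) ^ 2 + ∑ j : Fin n, (x.1 j.succ - y.1 j.succ) ^ 2 := by
  rw [Subtype.dist_eq, dist_eq_norm, EuclideanSpace.real_norm_sq_eq, Fin.sum_univ_succ]
  rfl

/-- On the sphere the contact equation for the lift reads `dt = 2 (1 - x₀ ^ 2) dx₀`, which
integrates to the chosen vertical coordinate. Hence the vertical part is of third order in the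
differences, better than the second order that the Lipschitz bound needs. -/
lemma hVert_whitney (x y : USphere n) : hVert (whitney x) (whitney y) =
    (x.1 0 - y.1 0) * ((x.1 0 - y.1 0) ^ 2 / 3 + ∑ j : Fin n, (x.1 j.succ - y.1 j.succ) ^ 2) := by
  have h1 : hForm (whitney x - whitney y) (whitney y) =
      (y.1 0 - x.1 0) * ∑ j : Fin n, x.1 j.succ * y.1 j.succ := by
    simp only [hForm, cx_sub, cy_sub, cx_whitney, cy_whitney, Finset.mul_sum]
    exact Finset.sum_congr rfl fun j _ => by ring
  have h2 : ∑ j : Fin n, (x.1 j.succ - y.1 j.succ) ^ 2 = ∑ j : Fin n, x.1 j.succ ^ 2 +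
      ∑ j : Fin n, y.1 j.succ ^ 2 - 2 * ∑ j : Fin n, x.1 j.succ * y.1 j.succ := by
    rw [Finset.mul_sum, ← Finset.sum_add_distrib, ← Finset.sum_sub_distrib]
    exact Finset.sum_congr rfl fun j _ => by ring
  rw [hVert_eq, h1, h2, ct_whitney, ct_whitney]
  have hx := sq_add_sum_sq_eq_one x
  have hy := sq_add_sum_sq_eq_one y
  linear_combination (-(x.1 0 - y.1 0)) * hx - (x.1 0 - y.1 0) * hy

lemma abs_coord_le_one (x : USphere n) (i : Fin (n + 1)) : |x.1 i| ≤ 1 := by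
  have h : ‖x.1‖ = 1 := by simp
  exact (PiLp.norm_apply_le x.1 i).trans h.le

lemma abs_coord_sub_le_dist (x y : USphere n) (i : Fin (n + 1)) : |x.1 i - y.1 i| ≤ dist x y := by
  rw [Subtype.dist_eq, dist_eq_norm]
  exact PiLp.norm_apply_le (x.1 - y.1) i

lemma dist_le_two (x y : USphere n) : dist x y ≤ 2 := by
  rw [Subtype.dist_eq]
  have hx : ‖x.1‖ = 1 := by simp
  have hy : ‖y.1‖ = 1 := by simp
  linarith [dist_le_norm_add_norm x.1 y.1]

lemma hDist_whitney_le (x y : USphere n) :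
    hDist (whitney x) (whitney y) ≤ (32 * n + 4) * dist x y := by
  set d := dist x y with hd
  have hd0 : 0 ≤ d := dist_nonneg
  have hd2 : d ≤ 2 := dist_le_two x y
  have hcoord : ∀ i : Fin (2 * n), |whitney x i.castSucc - whitney y i.castSucc| ≤ 2 * d := by
    have hy : ∀ j : Fin n, |cy (whitney x) j - cy (whitney y) j| ≤ 2 * d := fun j => by
      have e : x.1 0 * x.1 j.succ - y.1 0 * y.1 j.succ =
          x.1 0 * (x.1 j.succ - y.1 j.succ) + (x.1 0 - y.1 0) * y.1 j.succ := by ring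
      rw [cy_whitney, cy_whitney, e]
      refine (abs_add_le _ _).trans ?_
      rw [abs_mul, abs_mul]
      have h1 := mul_le_mul (abs_coord_le_one x 0) (abs_coord_sub_le_dist x y j.succ)
        (abs_nonneg _) zero_le_one
      have h2 := mul_le_mul (abs_coord_sub_le_dist x y 0) (abs_coord_le_one y j.succ)
        (abs_nonneg _) hd0
      linarith
    intro i
    rcases Nat.even_or_odd' i.1 with ⟨k, hk | hk⟩
    · have h1 := abs_coord_sub_le_dist x y (⟨k, by omega⟩ : Fin n).succ
      rw [← cx_whitney, ← cx_whitney] at h1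
      have e : i.castSucc = ⟨2 * k, by omega⟩ := Fin.ext hk
      rw [e]
      refine le_trans ?_ (show d ≤ 2 * d by linarith)
      exact h1
    · have h1 := hy ⟨k, by omega⟩
      have e : i.castSucc = ⟨2 * k + 1, by omega⟩ := Fin.ext hk
      rw [e]
      exact h1
  have hv : |hVert (whitney x) (whitney y)| ≤ 2 * d ^ 2 := by
    have h1 := dist_sq_eq x y
    rw [hVert_whitney, abs_mul]
    have h2 : 0 ≤ ∑ j : Fin n, (x.1 j.succ - y.1 j.succ) ^ 2 := by positivity
    rw [abs_of_nonneg (a := (x.1 0 - y.1 0) ^ 2 / 3 + _) (by positivity)]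
    refine mul_le_mul ((abs_coord_sub_le_dist x y 0).trans hd2) ?_ (by positivity) zero_le_two
    nlinarith [sq_nonneg (x.1 0 - y.1 0)]
  refine le_of_pow_le_pow_left₀ (n := 4) (by norm_num) (by positivity) ?_
  rw [hDist_pow, mul_pow]
  have h1 : ∑ i : Fin (2 * n), |whitney x i.castSucc - whitney y i.castSucc| ^ 4
      ≤ 32 * n * d ^ 4 := by
    calc _ ≤ ∑ _i : Fin (2 * n), (2 * d) ^ 4 :=
          Finset.sum_le_sum fun i _ => pow_le_pow_left₀ (abs_nonneg _) (hcoord i) 4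
      _ = _ := by simp; ring
  have h2 : |hVert (whitney x) (whitney y)| ^ 2 ≤ 4 * d ^ 4 := by
    calc _ ≤ (2 * d ^ 2) ^ 2 := pow_le_pow_left₀ (abs_nonneg _) hv 2
      _ = _ := by ring
  have h3 : (32 * n + 4 : ℝ) ≤ (32 * n + 4 : ℝ) ^ 4 :=
    le_self_pow₀ (by linarith [Nat.cast_nonneg (α := ℝ) n]) (by norm_num)
  nlinarith [mul_le_mul_of_nonneg_right h3 (show 0 ≤ d ^ 4 by positivity)]

/-- The coordinates `x_j` control `b` directly, so the point is to bound `a ^ 2`. The Whitney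
immersion identifies the poles `x₀ = ±1`; the vertical part separates them, through the `a ^ 4` term
of `hkey`. -/
lemma dist_le_hDist_whitney (x y : USphere n) :
    dist x y ≤ (10 * n + 2) * hDist (whitney x) (whitney y) := by
  set h := hDist (whitney x) (whitney y) with hh
  have hh0 : 0 ≤ h := hDist_nonneg _ _
  set a := x.1 0 - y.1 0 with ha
  set b := ∑ j : Fin n, (x.1 j.succ - y.1 j.succ) ^ 2 with hb
  have hX : ∀ j : Fin n, |x.1 j.succ - y.1 j.succ| ≤ h := fun j => by
    rw [← cx_whitney, ← cx_whitney]; exact abs_cx_sub_le_hDist _ _ j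
  have hY : ∀ j : Fin n, |x.1 0 * x.1 j.succ - y.1 0 * y.1 j.succ| ≤ h := fun j => by
    rw [← cy_whitney, ← cy_whitney]; exact abs_cy_sub_le_hDist _ _ j
  have hb_le : b ≤ n * h ^ 2 := by
    calc b ≤ ∑ _j : Fin n, h ^ 2 := Finset.sum_le_sum fun j _ =>
          sq_le_sq' (abs_le.1 (hX j)).1 (abs_le.1 (hX j)).2
      _ = _ := by simp
  have hb0 : 0 ≤ b := Finset.sum_nonneg fun j _ => sq_nonneg _
  have hx0 := abs_le.1 (abs_coord_le_one x 0)
  have hy0 := abs_le.1 (abs_coord_le_one y 0)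
  have hay : a ^ 2 * ∑ j : Fin n, y.1 j.succ ^ 2 ≤ n * (4 * h ^ 2) := by
    rw [Finset.mul_sum]
    calc _ ≤ ∑ _j : Fin n, 4 * h ^ 2 := Finset.sum_le_sum fun j _ => by
          have e : a * y.1 j.succ = (x.1 0 * x.1 j.succ - y.1 0 * y.1 j.succ) -
            x.1 0 * (x.1 j.succ - y.1 j.succ) := by rw [ha]; ring
          have h1 : |a * y.1 j.succ| ≤ 2 * h := by
            rw [e]
            refine (abs_sub _ _).trans ?_
            rw [abs_mul]
            have := mul_le_mul (abs_coord_le_one x 0) (hX j) (abs_nonneg _) zero_le_one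
            linarith [hY j]
          rw [← mul_pow]
          calc _ ≤ (2 * h) ^ 2 := sq_le_sq' (abs_le.1 h1).1 (abs_le.1 h1).2
            _ = _ := by ring
      _ = _ := by simp
  have hax : a ^ 2 * ∑ j : Fin n, x.1 j.succ ^ 2 ≤ n * (4 * h ^ 2) := by
    rw [Finset.mul_sum]
    calc _ ≤ ∑ _j : Fin n, 4 * h ^ 2 := Finset.sum_le_sum fun j _ => by
          have e : a * x.1 j.succ = (x.1 0 * x.1 j.succ - y.1 0 * y.1 j.succ) -
            y.1 0 * (x.1 j.succ - y.1 j.succ) := by rw [ha]; ring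
          have h1 : |a * x.1 j.succ| ≤ 2 * h := by
            rw [e]
            refine (abs_sub _ _).trans ?_
            rw [abs_mul]
            have := mul_le_mul (abs_coord_le_one y 0) (hX j) (abs_nonneg _) zero_le_one
            linarith [hY j]
          rw [← mul_pow]
          calc _ ≤ (2 * h) ^ 2 := sq_le_sq' (abs_le.1 h1).1 (abs_le.1 h1).2
            _ = _ := by ring
      _ = _ := by simp
  have hv : |a| ^ 3 ≤ 3 * h ^ 2 := by
    have h1 := abs_hVert_le (whitney x) (whitney y)
    rw [hVert_whitney, abs_mul, abs_of_nonneg (a := a ^ 2 / 3 + b) (by positivity)] at h1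
    have h2 : 0 ≤ |a| * b := by positivity
    have h3 : |a| ^ 3 = |a| * a ^ 2 := by rw [pow_succ', sq_abs]
    rw [h3]
    linarith
  have ha4 : a ^ 4 ≤ 6 * h ^ 2 := by
    have h1 : |a| ≤ 2 := by rw [abs_le]; constructor <;> linarith
    have h2 : a ^ 4 = |a| * |a| ^ 3 := by rw [← pow_succ', ← abs_pow, abs_of_nonneg (Even.pow_nonneg (by decide) a)]
    rw [h2]
    have := mul_le_mul h1 hv (by positivity) zero_le_two
    linarith
  have hs := sq_add_sum_sq_eq_one x
  have ht := sq_add_sum_sq_eq_one y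
  -- The difference of the two sphere equations expresses `x₀ ^ 2 - y₀ ^ 2` through the other
  -- coordinates; then Cauchy-Schwarz.
  have hsum : (a * (x.1 0 + y.1 0)) ^ 2 ≤ 4 * b := by
    have e : a * (x.1 0 + y.1 0) =
        -∑ j : Fin n, (x.1 j.succ - y.1 j.succ) * (x.1 j.succ + y.1 j.succ) := by
      have : ∑ j : Fin n, (x.1 j.succ - y.1 j.succ) * (x.1 j.succ + y.1 j.succ) =
          ∑ j : Fin n, x.1 j.succ ^ 2 - ∑ j : Fin n, y.1 j.succ ^ 2 := by
        rw [← Finset.sum_sub_distrib]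
        exact Finset.sum_congr rfl fun j _ => by ring
      rw [this, ha]
      linear_combination hs - ht
    rw [e, neg_sq]
    refine (Finset.sum_mul_sq_le_sq_mul_sq _ _ _).trans ?_
    have h1 : ∑ j : Fin n, (x.1 j.succ + y.1 j.succ) ^ 2 ≤ 4 := by
      calc _ ≤ ∑ j : Fin n, (2 * x.1 j.succ ^ 2 + 2 * y.1 j.succ ^ 2) :=
            Finset.sum_le_sum fun j _ => by nlinarith [sq_nonneg (x.1 j.succ - y.1 j.succ)]
        _ = 2 * ∑ j : Fin n, x.1 j.succ ^ 2 + 2 * ∑ j : Fin n, y.1 j.succ ^ 2 := by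
            rw [Finset.sum_add_distrib, Finset.mul_sum, Finset.mul_sum]
        _ ≤ 4 := by nlinarith [sq_nonneg (x.1 0), sq_nonneg (y.1 0)]
    rw [mul_comm 4 b]
    gcongr
  -- By the sphere equations, `4 = (x₀ + y₀) ^ 2 + (x₀ - y₀) ^ 2 + 2 (1 - x₀ ^ 2) + 2 (1 - y₀ ^ 2)`
  -- splits `a ^ 2` into terms already bounded by multiples of `h ^ 2`.
  have hkey : 4 * a ^ 2 = (a * (x.1 0 + y.1 0)) ^ 2 + a ^ 4 +
      2 * (a ^ 2 * ∑ j : Fin n, x.1 j.succ ^ 2) + 2 * (a ^ 2 * ∑ j : Fin n, y.1 j.succ ^ 2) := by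
    have e1 : ∑ j : Fin n, x.1 j.succ ^ 2 = 1 - x.1 0 ^ 2 := by linarith
    have e2 : ∑ j : Fin n, y.1 j.succ ^ 2 = 1 - y.1 0 ^ 2 := by linarith
    rw [e1, e2, ha]
    ring
  refine le_of_pow_le_pow_left₀ two_ne_zero (by positivity) ?_
  rw [dist_sq_eq, mul_pow]
  have hn : (0 : ℝ) ≤ n := Nat.cast_nonneg n
  have h1 : a ^ 2 + b ≤ (6 * n + 3 / 2) * h ^ 2 := by
    linarith
  refine h1.trans (mul_le_mul_of_nonneg_right ?_ (sq_nonneg h))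
  nlinarith

theorem isBiLip_whitney : IsBiLip (whitney : USphere n → Heis n) := by
  have hn : (0 : ℝ) ≤ n := Nat.cast_nonneg n
  refine ⟨32 * n + 4, by positivity, fun x y => ⟨?_, hDist_whitney_le x y⟩⟩
  rw [inv_mul_le_iff₀ (by positivity)]
  refine (dist_le_hDist_whitney x y).trans
    (mul_le_mul_of_nonneg_right (by linarith) (hDist_nonneg _ _))

lemma IsBiLip.isLipEmbedding {X : Type*} [MetricSpace X] {f : X → Heis n} (hf : IsBiLip f) :
    IsLipEmbedding f := by
  obtain ⟨L, hL, h⟩ := hf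
  refine ⟨⟨L, hL.le, fun x y => (h x y).2⟩, fun x y hxy => ?_⟩
  have h1 := (h x y).1
  rw [hxy, hDist_self] at h1
  have h2 : dist x y ≤ 0 := by
    rwa [inv_mul_le_iff₀ hL, mul_zero] at h1
  exact dist_le_zero.1 h2

end HeisenbergLip

theorem mainTheorem8 (n : ℕ) (hn : 1 ≤ n) :
    -- no Lipschitz embedding of the sphere extends to a Lipschitz map of the ball
    (∀ φ : HeisenbergLip.USphere n → HeisenbergLip.Heis n, HeisenbergLip.IsLipEmbedding φ →
      ¬ ∃ Φ : HeisenbergLip.UBall (n + 1) → HeisenbergLip.Heis n,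
        HeisenbergLip.IsLip Φ ∧ ∀ x, Φ (HeisenbergLip.sphereIncl x) = φ x) ∧
    -- every Lipschitz embedding is a nontrivial element of the Lipschitz homotopy group
    (∀ φ : HeisenbergLip.LipMap n n, HeisenbergLip.IsLipEmbedding φ.1 →
      ∀ c : HeisenbergLip.Heis n,
        HeisenbergLip.lipClass φ ≠ HeisenbergLip.lipClass (HeisenbergLip.constMap n c)) ∧
    -- there is a bi-Lipschitz embedding of the sphere
    (∃ φ : HeisenbergLip.USphere n → HeisenbergLip.Heis n, HeisenbergLip.IsBiLip φ) ∧
    -- the Lipschitz homotopy group is not trivial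
    (∃ a : HeisenbergLip.PiLip n n, ∀ c : HeisenbergLip.Heis n,
      a ≠ HeisenbergLip.lipClass (HeisenbergLip.constMap n c)) ∧
    -- no open set of dimension greater than `n` has an injective Lipschitz map into `ℍ_n`
    (∀ k : ℕ, n + 1 ≤ k → ∀ Ω : Set (EuclideanSpace ℝ (Fin k)), IsOpen Ω → Ω.Nonempty →
      ¬ ∃ f : Ω → HeisenbergLip.Heis n,
        HeisenbergLip.IsLip f ∧ Function.Injective f) := by
  refine ⟨?_, ?_, ?_, ?_, ?_⟩
  · exact fun φ hφ => HeisenbergLip.not_exists_lipschitz_extension hφ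
  · exact fun φ hφ c => HeisenbergLip.lipClass_ne_const hφ c
  · exact ⟨_, HeisenbergLip.isBiLip_whitney⟩
  · have hw := (HeisenbergLip.isBiLip_whitney (n := n)).isLipEmbedding
    let w : HeisenbergLip.LipMap n n := ⟨HeisenbergLip.whitney, hw.1⟩
    exact ⟨HeisenbergLip.lipClass w, HeisenbergLip.lipClass_ne_const (φ := w) hw⟩
  · exact fun k hk Ω hΩ hne => HeisenbergLip.not_exists_injective_lipschitz hk hΩ hne
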